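/- Let $p$ be a prime. An extra-special $p$-group is a finite $p$-group whose centre has order $p$ and equals its derived subgroup, and whose quotient by the centre is elementary abelian. For a group $G$ and a $2$-cocycle $\alpha\in Z^2(G,\mathbb{C}^\times)$ (trivial action), let $\mathbb{C}^\alpha G$ be the twisted group algebra: the $\mathbb{C}$-vector space with basis $\{\bar g : g\in G\}$ and multiplication determined by $\bar g\,\bar h=\alpha(g,h)\,\overline{gh}$; up to isomorphism it depends only on the class $[\alpha]\in \mathrm{H}^2(G,\mathbb{C}^\times)$. Write $G\sim_{\mathbb{C}}H$ if there is a group isomorphism $\phi:\mathrm{H}^2(G,\mathbb{C}^\times)\to \mathrm{H}^2(H,\mathbb{C}^\times)$ such that $\mathbb{C}^{\alpha}G\cong\mathbb{C}^{\phi(\alpha)}H$ as $\mathbb{C}$-algebras for every $[\alpha]\in \mathrm{H}^2(G,\mathbb{C}^\times)$, where $\mathbb{C}^{\phi(\alpha)}H$ denotes the twisted group algebra of any cocycle representing $\phi([\alpha])$. Theorem. Let $G$ and $H$ be extra-special $p$-groups of order $p^{2n+1}$, where $n\ge 1$. (i) If $n=1$, then the equivalence class of $G$ with respect to $\sim_{\mathbb{C}}$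 consists of a single group up to isomorphism: for every group $K$, $G\sim_{\mathbb{C}}K$ if and only if $G\cong K$. (ii) If $n>1$, then $G\sim_{\mathbb{C}}H$. -/

import Mathlib

noncomputable section

/-- The trivial `G`-module `Rˣ` (written additively), the coefficients of the cohomology below. -/
abbrev unitsRep (R G : Type) [CommRing R] [Group G] : Rep ℤ G :=
  Rep.trivial ℤ G (Additive Rˣ)

/-- The group `Z²(G, Rˣ)` of `2`-cocycles for the trivial action (written additively). -/
abbrev TwoCocycle (R G : Type) [CommRing R] [Group G] : Type :=
  groupCohomology.cocycles₂ (unitsRep R G)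

/-- The second cohomology group `H²(G, Rˣ)` for the trivial action (written additively). -/
abbrev SecondCohomology (R G : Type) [CommRing R] [Group G] : Type :=
  groupCohomology.H2 (unitsRep R G)

/-- The class `[α] ∈ H²(G, Rˣ)` of a `2`-cocycle `α`. -/
def cohomologyClass {R G : Type} [CommRing R] [Group G] (α : TwoCocycle R G) :
    SecondCohomology R G :=
  groupCohomology.H2π (unitsRep R G) α

/-- The value `α(g, h)`, as an element of `R`. -/
def TwoCocycle.val {R G : Type} [CommRing R] [Group G] (α : TwoCocycle R G) (g h : G) : R :=
  ((Additive.toMul (α (g, h) : Additive Rˣ) : Rˣ) : R)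

/-- The value `α(g, h)⁻¹`, as an element of `R`. -/
def TwoCocycle.invVal {R G : Type} [CommRing R] [Group G] (α : TwoCocycle R G) (g h : G) : R :=
  (((Additive.toMul (α (g, h) : Additive Rˣ) : Rˣ)⁻¹ : Rˣ) : R)

section cocycleLemmas

variable {R G : Type} [CommRing R] [Group G] (α : TwoCocycle R G)

theorem TwoCocycle.val_mul_val (g h j : G) :
    α.val (g * h) j * α.val g h = α.val h j * α.val g (h * j) := by
  have h1 := (groupCohomology.mem_cocycles₂_iff (A := unitsRep R G) α).1 α.2 g h j
  have h2 := congrArg (fun x : Additive Rˣ => ((Additive.toMul x : Rˣ) : R)) h1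
  simpa [TwoCocycle.val] using h2

theorem TwoCocycle.val_one_left (g : G) : α.val 1 g = α.val 1 1 :=
  congrArg (fun x : Additive Rˣ => ((Additive.toMul x : Rˣ) : R))
    (groupCohomology.cocycles₂_map_one_fst (A := unitsRep R G) α g)

theorem TwoCocycle.val_one_right (g : G) : α.val g 1 = α.val 1 1 :=
  congrArg (fun x : Additive Rˣ => ((Additive.toMul x : Rˣ) : R))
    (groupCohomology.cocycles₂_map_one_snd (A := unitsRep R G) α g)

theorem TwoCocycle.invVal_mul_val (g h : G) : α.invVal g h * α.val g h = 1 :=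
  Units.inv_mul _

end cocycleLemmas

/-- The multiplication of the twisted group ring on finite formal sums:
`(∑ x_g ḡ) (∑ y_h h̄) = ∑ x_g y_h α(g, h) \overline{gh}`. -/
def twistedMul {R G : Type} [CommRing R] [Group G] (α : TwoCocycle R G) (x y : G →₀ R) : G →₀ R :=
  x.sum fun g a => y.sum fun h b => Finsupp.single (g * h) (a * b * α.val g h)

section twistedMulLemmas

variable {R G : Type} [CommRing R] [Group G] (α : TwoCocycle R G)

theorem twistedMul_add_left (x y z : G →₀ R) :
    twistedMul α (x + y) z = twistedMul α x z + twistedMul α y z := by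
  refine Finsupp.sum_add_index' (fun g => ?_) (fun g a b => ?_)
  · simp
  · rw [← Finsupp.sum_add]
    simp only [add_mul, Finsupp.single_add]

theorem twistedMul_add_right (x y z : G →₀ R) :
    twistedMul α x (y + z) = twistedMul α x y + twistedMul α x z := by
  simp only [twistedMul]
  rw [← Finsupp.sum_add]
  refine Finsupp.sum_congr fun g _ => ?_
  refine Finsupp.sum_add_index' (fun h => ?_) (fun h a b => ?_)
  · simp
  · simp only [mul_add, add_mul, Finsupp.single_add]

theorem twistedMul_zero_left (x : G →₀ R) : twistedMul α 0 x = 0 := Finsupp.sum_zero_index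

theorem twistedMul_zero_right (x : G →₀ R) : twistedMul α x 0 = 0 :=
  Finset.sum_eq_zero fun _ _ => Finsupp.sum_zero_index

theorem twistedMul_single (g h : G) (a b : R) :
    twistedMul α (Finsupp.single g a) (Finsupp.single h b) =
      Finsupp.single (g * h) (a * b * α.val g h) := by
  refine (Finsupp.sum_single_index ?_).trans (Finsupp.sum_single_index ?_) <;> simp

theorem twistedMul_assoc (x y z : G →₀ R) :
    twistedMul α (twistedMul α x y) z = twistedMul α x (twistedMul α y z) := by
  refine Finsupp.induction_linear x (by simp only [twistedMul_zero_left])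
    (fun x₁ x₂ h₁ h₂ => by simp only [twistedMul_add_left, h₁, h₂]) (fun g a => ?_)
  refine Finsupp.induction_linear y (by simp only [twistedMul_zero_left, twistedMul_zero_right])
    (fun x₁ x₂ h₁ h₂ => by simp only [twistedMul_add_left, twistedMul_add_right, h₁, h₂])
    (fun h b => ?_)
  refine Finsupp.induction_linear z (by simp only [twistedMul_zero_right])
    (fun x₁ x₂ h₁ h₂ => by simp only [twistedMul_add_right, h₁, h₂]) (fun j c => ?_)
  simp only [twistedMul_single, mul_assoc g h j]
  congr 1
  linear_combination (a * b * c) * α.val_mul_val g h j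

theorem twistedMul_one_left (x : G →₀ R) :
    twistedMul α (Finsupp.single 1 (α.invVal 1 1)) x = x := by
  refine Finsupp.induction_linear x (twistedMul_zero_right α _)
    (fun x₁ x₂ h₁ h₂ => by simp only [twistedMul_add_right, h₁, h₂]) (fun g a => ?_)
  rw [twistedMul_single, one_mul, α.val_one_left]
  congr 1
  linear_combination a * α.invVal_mul_val 1 1

theorem twistedMul_one_right (x : G →₀ R) :
    twistedMul α x (Finsupp.single 1 (α.invVal 1 1)) = x := by
  refine Finsupp.induction_linear x (twistedMul_zero_left α _)
    (fun x₁ x₂ h₁ h₂ => by simp only [twistedMul_add_left, h₁, h₂]) (fun g a => ?_)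
  rw [twistedMul_single, mul_one, α.val_one_right]
  congr 1
  linear_combination a * α.invVal_mul_val 1 1

theorem twistedMul_smul_left (r : R) (x y : G →₀ R) :
    twistedMul α (r • x) y = r • twistedMul α x y := by
  refine Finsupp.induction_linear x (by simp only [smul_zero, twistedMul_zero_left])
    (fun x₁ x₂ h₁ h₂ => by simp only [smul_add, twistedMul_add_left, h₁, h₂]) (fun g a => ?_)
  refine Finsupp.induction_linear y (by simp only [smul_zero, twistedMul_zero_right])
    (fun x₁ x₂ h₁ h₂ => by simp only [smul_add, twistedMul_add_right, h₁, h₂]) (fun h b => ?_)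
  simp only [Finsupp.smul_single, twistedMul_single, smul_eq_mul, mul_assoc]

theorem twistedMul_smul_right (r : R) (x y : G →₀ R) :
    twistedMul α x (r • y) = r • twistedMul α x y := by
  refine Finsupp.induction_linear x (by simp only [smul_zero, twistedMul_zero_left])
    (fun x₁ x₂ h₁ h₂ => by simp only [smul_add, twistedMul_add_left, h₁, h₂]) (fun g a => ?_)
  refine Finsupp.induction_linear y (by simp only [smul_zero, twistedMul_zero_right])
    (fun x₁ x₂ h₁ h₂ => by simp only [smul_add, twistedMul_add_right, h₁, h₂]) (fun h b => ?_)
  simp only [Finsupp.smul_single, twistedMul_single, smul_eq_mul]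
  congr 1
  ring

end twistedMulLemmas

/-- The twisted group ring `R^α G`: the free `R`-module with basis `{ḡ | g ∈ G}`, where
`ḡ = Finsupp.single g 1`, with multiplication `ḡ h̄ = α(g, h) \overline{gh}`
and identity `α(1, 1)⁻¹ \overline{1}`. -/
def TwistedGroupRing {R G : Type} [CommRing R] [Group G] (_α : TwoCocycle R G) : Type :=
  G →₀ R

namespace TwistedGroupRing

variable {R G : Type} [CommRing R] [Group G] {α : TwoCocycle R G}

instance : AddCommGroup (TwistedGroupRing α) := inferInstanceAs (AddCommGroup (G →₀ R))

instance : Module R (TwistedGroupRing α) := inferInstanceAs (Module R (G →₀ R))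

instance : Ring (TwistedGroupRing α) :=
  { (inferInstance : AddCommGroup (TwistedGroupRing α)) with
    mul := twistedMul α
    one := (Finsupp.single 1 (α.invVal 1 1) : G →₀ R)
    left_distrib := twistedMul_add_right α
    right_distrib := twistedMul_add_left α
    zero_mul := twistedMul_zero_left α
    mul_zero := twistedMul_zero_right α
    mul_assoc := twistedMul_assoc α
    one_mul := twistedMul_one_left α
    mul_one := twistedMul_one_right α }

instance : Algebra R (TwistedGroupRing α) :=
  Algebra.ofModule (twistedMul_smul_left α) (twistedMul_smul_right α)

end TwistedGroupRing

/-- The relation `G ∼_R H`: there is a group isomorphism `φ : H²(G, Rˣ) → H²(H, Rˣ)` such that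
`R^α G ≅ R^{φ(α)} H` as `R`-algebras for every class `[α]`. Up to isomorphism, `R^α G` depends only
on `[α]`; the definition asks for the isomorphism for all representatives `α` of `[α]` and `β` of
`φ([α])`. -/
def TwistedGroupRingRel (R G H : Type) [CommRing R] [Group G] [Group H] : Prop :=
  ∃ φ : SecondCohomology R G ≃+ SecondCohomology R H,
    ∀ (α : TwoCocycle R G) (β : TwoCocycle R H),
      φ (cohomologyClass α) = cohomologyClass β →
        Nonempty (TwistedGroupRing α ≃ₐ[R] TwistedGroupRing β)

/-- An extra-special `p`-group: a `p`-group whose centre has order `p` and coincides with the derived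
subgroup, and whose central quotient is elementary abelian. -/
structure IsExtraSpecial (p : ℕ) (G : Type) [Group G] : Prop where
  isPGroup : IsPGroup p G
  center_eq_commutator : Subgroup.center G = commutator G
  card_center : Nat.card (Subgroup.center G) = p
  pow_mem_center : ∀ g : G, g ^ p ∈ Subgroup.center G

end

/-! ### Divisibility of ℂˣ and extension of characters. -/

open scoped commutatorElement

/-! A cocycle is studied through the central extension of the group by ℂˣ that it defines. Since ℂˣ
is divisible, characters trivial on commutators extend from subgroups, and this decides when a class
vanishes (`exists_coboundary`).

For n > 1, the quotient of G by its centre is an 𝔽_p-space V of dimension 2n on which commutators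
induce a nondegenerate alternating form B. Such forms are unique up to isometry, so G and H are
central extensions of the same (V, B) by 𝔽_p. A bilinear form b on V gives the cocycle ζ^b(g,h).
Since 2n ≥ 3, the preimage of the centre of G in any extension by ℂˣ stays central
(`commute_of_proj_eq_one`), so the commutator pairing of the extension lives on V and every class
comes from some b (`exists_class_cocycle_eq`). The class of b vanishes exactly when b - bᵗ is a
multiple of B (`class_cocycle_eq_zero_iff`), a condition that does not see the group. Hence both H²
are the same quotient of the space of bilinear forms. For a fixed b the two algebras are isomorphic:
they split along the characters of the central 𝔽_p, and on each block a character of the fibre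
product of G and H over V carries one onto the other (`nonempty_algEquiv_cocycle`).

For n = 1, the zero class gives ℂG ≅ ℂK, so K is nonabelian of order p³. There are two types of such
groups (`exists_pairRel`), told apart by H². In the type with a^p = [a,b], lifts of generators to an
extension by ℂˣ can be rescaled to satisfy the defining relations, so every extension splits. In the
type with a^p = b^p = 1, an explicit projective representation of degree p does not lift. -/

theorem exists_pow_eq_units (n : ℕ) (hn : n ≠ 0) (x : ℂˣ) : ∃ y : ℂˣ, y ^ n = x := by
  obtain ⟨z, hz⟩ := IsAlgClosed.exists_pow_nat_eq (x : ℂ) (Nat.pos_of_ne_zero hn)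
  have hz0 : z ≠ 0 := by
    rintro rfl
    rw [zero_pow hn] at hz
    exact x.ne_zero hz.symm
  exact ⟨Units.mk0 z hz0, Units.ext hz⟩

noncomputable instance : RootableBy ℂˣ ℕ :=
  rootableByOfPowLeftSurj _ _ fun {n} hn x => exists_pow_eq_units n hn x

noncomputable instance : DivisibleBy (Additive ℂˣ) ℕ where
  div a n := Additive.ofMul (RootableBy.root a.toMul n)
  div_zero a := congrArg Additive.ofMul (RootableBy.root_zero a.toMul)
  div_cancel {_} a hn := congrArg Additive.ofMul (RootableBy.root_cancel a.toMul hn)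

noncomputable instance : DivisibleBy (Additive ℂˣ) ℤ :=
  AddGroup.divisibleByIntOfDivisibleByNat (Additive ℂˣ)

/-- A character of a subgroup extends to the whole group if it is trivial on commutators. -/
theorem exists_monoidHom_extension {E : Type} [Group E] (N : Subgroup E) (χ : N →* ℂˣ)
    (h : ∀ x : N, (x : E) ∈ commutator E → χ x = 1) : ∃ X : E →* ℂˣ, ∀ x : N, X x = χ x := by
  let f : N →* Abelianization E := Abelianization.of.comp N.subtype
  -- The condition on commutators lets χ descend to the image of `N` in the abelianization, where
  -- injectivity of the divisible group ℂˣ extends it.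
  have hker : f.rangeRestrict.ker ≤ χ.ker := by
    intro x hx
    rw [MonoidHom.ker_rangeRestrict, MonoidHom.mem_ker] at hx
    exact h x (by rw [← Abelianization.ker_of]; exact hx)
  let χ' : f.range →* ℂˣ :=
    f.rangeRestrict.liftOfSurjective f.rangeRestrict_surjective ⟨χ, hker⟩
  let i : AddCommGrpCat.of (Additive f.range) ⟶ AddCommGrpCat.of (Additive (Abelianization E)) :=
    AddCommGrpCat.ofHom f.range.subtype.toAdditive
  have : CategoryTheory.Mono i := by
    rw [AddCommGrpCat.mono_iff_injective]
    exact f.range.subtype_injective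
  obtain ⟨Y, hY⟩ := CategoryTheory.Injective.factors
    (J := AddCommGrpCat.of (Additive ℂˣ)) (AddCommGrpCat.ofHom χ'.toAdditive) i
  let Z : Additive (Abelianization E) →+ Additive ℂˣ := Y.hom
  refine ⟨(MonoidHom.toAdditive.symm Z).comp Abelianization.of, fun x => ?_⟩
  have h1 : Z (Additive.ofMul (f x)) = Additive.ofMul (χ' (f.rangeRestrict x)) :=
    congrArg (fun k => k.hom (Additive.ofMul (f.rangeRestrict x))) hY
  have h2 : χ' (f.rangeRestrict x) = χ x :=
    MonoidHom.liftOfRightInverse_comp_apply _ _ _ ⟨χ, hker⟩ x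
  rw [h2] at h1
  exact h1

/-! ### Central extensions defined by cocycles. -/

/-- The `2`-cocycle identity for the trivial action on `ℂˣ`. -/
def IsCocycle {G : Type} [Group G] (f : G → G → ℂˣ) : Prop :=
  ∀ g h j, f (g * h) j * f g h = f h j * f g (h * j)

namespace IsCocycle

variable {G : Type} [Group G] {f : G → G → ℂˣ}

theorem one_left (hf : IsCocycle f) (g : G) : f 1 g = f 1 1 := by
  have := hf 1 1 g
  simp only [one_mul] at this
  exact (mul_left_cancel this).symm

theorem one_right (hf : IsCocycle f) (g : G) : f g 1 = f 1 1 := by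
  have := hf g 1 1
  simp only [mul_one] at this
  exact mul_right_cancel this

/-- The central extension of `G` by `ℂˣ` defined by a `2`-cocycle. -/
@[ext]
structure Extension (hf : IsCocycle f) : Type where
  fst : G
  snd : ℂˣ

instance (hf : IsCocycle f) : Mul hf.Extension :=
  ⟨fun x y => ⟨x.fst * y.fst, x.snd * y.snd * f x.fst y.fst⟩⟩

/-- Cocycles are not assumed normalized, so the identity carries the factor `(f 1 1)⁻¹`. -/
instance (hf : IsCocycle f) : One hf.Extension := ⟨⟨1, (f 1 1)⁻¹⟩⟩

instance (hf : IsCocycle f) : Inv hf.Extension :=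
  ⟨fun x => ⟨x.fst⁻¹, x.snd⁻¹ * (f x.fst⁻¹ x.fst)⁻¹ * (f 1 1)⁻¹⟩⟩

instance (hf : IsCocycle f) : Group hf.Extension :=
  Group.ofLeftAxioms
    (fun x y z => Extension.ext (mul_assoc _ _ _) (by
      change x.snd * y.snd * f x.fst y.fst * z.snd * f (x.fst * y.fst) z.fst =
        x.snd * (y.snd * z.snd * f y.fst z.fst) * f x.fst (y.fst * z.fst)
      calc _ = x.snd * y.snd * z.snd * (f (x.fst * y.fst) z.fst * f x.fst y.fst) := by
            simp only [mul_comm, mul_left_comm]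
        _ = _ := by rw [hf]; simp only [mul_assoc]))
    (fun x => Extension.ext (one_mul _) (by
      change (f 1 1)⁻¹ * x.snd * f 1 x.fst = x.snd
      rw [hf.one_left x.fst, mul_right_comm _ x.snd, inv_mul_cancel, one_mul]))
    (fun x => Extension.ext (inv_mul_cancel _) (by
      change x.snd⁻¹ * (f x.fst⁻¹ x.fst)⁻¹ * (f 1 1)⁻¹ * x.snd * f x.fst⁻¹ x.fst = (f 1 1)⁻¹
      exact Units.ext (by push_cast; field_simp)))

variable (hf : IsCocycle f)

/-- The projection of the extension onto `G`. -/
def proj : hf.Extension →* G where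
  toFun x := x.fst
  map_one' := rfl
  map_mul' _ _ := rfl

/-- The inclusion of `ℂˣ` into the extension. -/
def incl : ℂˣ →* hf.Extension where
  toFun m := ⟨1, m * (f 1 1)⁻¹⟩
  map_one' := Extension.ext rfl (one_mul _)
  map_mul' m n := Extension.ext (one_mul _).symm (by
    change m * n * (f 1 1)⁻¹ = m * (f 1 1)⁻¹ * (n * (f 1 1)⁻¹) * f 1 1
    exact Units.ext (by push_cast; field_simp))

/-- The standard lift of an element of `G` to the extension. -/
def lift (g : G) : hf.Extension := ⟨g, 1⟩

theorem ext_mul_fst (x y : hf.Extension) : (x * y).fst = x.fst * y.fst := rfl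

theorem ext_mul_snd (x y : hf.Extension) : (x * y).2 = x.snd * y.snd * f x.fst y.fst := rfl

@[simp] theorem proj_lift (g : G) : hf.proj (hf.lift g) = g := rfl

@[simp] theorem proj_incl (m : ℂˣ) : hf.proj (hf.incl m) = 1 := rfl

theorem incl_mul_lift (m : ℂˣ) (g : G) : hf.incl m * hf.lift g = ⟨g, m⟩ :=
  Extension.ext (one_mul _) (by
    change m * (f 1 1)⁻¹ * 1 * f 1 g = m
    rw [hf.one_left g]
    exact Units.ext (by push_cast; field_simp))

theorem lift_mul_incl (m : ℂˣ) (g : G) : hf.lift g * hf.incl m = ⟨g, m⟩ :=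
  Extension.ext (mul_one _) (by
    change 1 * (m * (f 1 1)⁻¹) * f g 1 = m
    rw [hf.one_right g]
    exact Units.ext (by push_cast; field_simp))

theorem eq_incl_mul_lift (x : hf.Extension) : x = hf.incl x.snd * hf.lift x.fst :=
  (hf.incl_mul_lift _ _).symm

theorem incl_commute (m : ℂˣ) (x : hf.Extension) : Commute (hf.incl m) x := by
  rw [hf.eq_incl_mul_lift x]
  refine Commute.mul_right ?_ ?_
  · rw [commute_iff_eq, ← map_mul, ← map_mul, mul_comm]
  · rw [commute_iff_eq, incl_mul_lift, lift_mul_incl]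

theorem incl_injective : Function.Injective hf.incl := fun m n h =>
  mul_right_cancel (congrArg Extension.snd h : m * (f 1 1)⁻¹ = n * (f 1 1)⁻¹)

theorem exists_incl_eq {x : hf.Extension} (hx : hf.proj x = 1) : ∃ m, hf.incl m = x :=
  ⟨x.snd * f 1 1, Extension.ext hx.symm (mul_inv_cancel_right _ _)⟩

theorem lift_mul_lift (g h : G) : hf.lift g * hf.lift h = hf.incl (f g h) * hf.lift (g * h) := by
  rw [incl_mul_lift]
  exact Extension.ext rfl (by change 1 * 1 * f g h = f g h; simp)

/-- A cocycle is a coboundary if its restriction to a subgroup `N` containing all commutators is the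
coboundary of some `r`, and `r` is compatible with the commutators in the extension. -/
theorem exists_coboundary (hf : IsCocycle f) (N : Subgroup G) (r : G → ℂˣ)
    (hr : ∀ x ∈ N, ∀ y ∈ N, r x * r y = f x y * r (x * y))
    (hN : ∀ g h : G, ⁅g, h⁆ ∈ N)
    (hc : ∀ g h : G, f g h * r ⁅g, h⁆ = f h g * f ⁅g, h⁆ (h * g)) :
    ∃ c : G → ℂˣ, ∀ g h, c g * c h = f g h * c (g * h) := by
  -- By `hr` this is a homomorphism on the preimage of `N`, and it is the identity on ℂˣ.
  let ρ : N.comap hf.proj →* ℂˣ := MonoidHom.mk' (fun x => x.1.snd * r x.1.fst) (by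
    rintro ⟨x, hx⟩ ⟨y, hy⟩
    change x.snd * y.snd * f x.fst y.fst * r (x.fst * y.fst) = x.snd * r x.fst * (y.snd * r y.fst)
    rw [mul_assoc (x.snd * y.snd)]
    refine (congrArg (x.snd * y.snd * ·) (hr _ hx _ hy).symm).trans ?_
    exact mul_mul_mul_comm _ _ _ _)
  -- `hc` is exactly the condition that ρ kills commutators. So ρ extends to the whole extension,
  -- and composing with the standard lift gives the cochain.
  have hcomm : commutator hf.Extension ≤ ρ.ker.map (N.comap hf.proj).subtype := by
    rw [commutator_eq_closure, Subgroup.closure_le]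
    rintro _ ⟨x, y, rfl⟩
    have hmem : ⁅x, y⁆ ∈ N.comap hf.proj := by
      rw [Subgroup.mem_comap, map_commutatorElement]
      exact hN _ _
    refine ⟨⟨⁅x, y⁆, hmem⟩, ?_, rfl⟩
    rw [SetLike.mem_coe, MonoidHom.mem_ker]
    have h1 : ⁅x, y⁆ * (y * x) = x * y := by rw [commutatorElement_def]; group
    have h2 := congrArg Extension.snd h1
    have h3 : (⁅x, y⁆ : hf.Extension).fst = ⁅x.fst, y.fst⁆ := map_commutatorElement hf.proj x y
    simp only [ext_mul_snd, ext_mul_fst, h3] at h2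
    change (⁅x, y⁆ : hf.Extension).snd * r (⁅x, y⁆ : hf.Extension).fst = 1
    rw [h3]
    have h4 := hc x.fst y.fst
    set k := (⁅x, y⁆ : hf.Extension).snd
    have h5 : k * r ⁅x.fst, y.fst⁆ * (x.snd * y.snd * f x.fst y.fst) = x.snd * y.snd * f x.fst y.fst := by
      calc _ = k * (x.snd * y.snd) * (f x.fst y.fst * r ⁅x.fst, y.fst⁆) := by
            simp only [mul_comm, mul_left_comm, mul_assoc]
        _ = k * (y.snd * x.snd * f y.fst x.fst) * f ⁅x.fst, y.fst⁆ (y.fst * x.fst) := by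
            rw [h4]; simp only [mul_comm, mul_left_comm, mul_assoc]
        _ = _ := h2
    exact mul_eq_right.mp h5
  obtain ⟨X, hX⟩ := exists_monoidHom_extension _ ρ (fun x hx => by
    obtain ⟨y, hy, hyx⟩ := hcomm hx
    rw [← Subtype.ext hyx]
    exact hy)
  have hr1 : r 1 = f 1 1 := by
    have := hr 1 N.one_mem 1 N.one_mem
    rw [mul_one] at this
    exact mul_right_cancel this
  have hincl : ∀ m, X (hf.incl m) = m := fun m => by
    refine (hX ⟨hf.incl m, by rw [Subgroup.mem_comap, proj_incl]; exact N.one_mem⟩).trans ?_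
    change m * (f 1 1)⁻¹ * r 1 = m
    rw [hr1, inv_mul_cancel_right]
  refine ⟨fun g => X (hf.lift g), fun g h => ?_⟩
  rw [← map_mul, lift_mul_lift, map_mul, hincl]

/-- A cocycle is a coboundary if the extension splits. -/
theorem exists_coboundary_of_section (σ : G →* hf.Extension) (hσ : ∀ g, hf.proj (σ g) = g) :
    ∃ c : G → ℂˣ, ∀ g h, c g * c h = f g h * c (g * h) := by
  -- The scalar coordinate s of σ satisfies s(g) s(h) f(g,h) = s(gh), hence the inverse.
  refine ⟨fun g => ((σ g).snd)⁻¹, fun g h => ?_⟩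
  have h1 : (σ g).fst = g := hσ g
  have h2 : (σ h).fst = h := hσ h
  change ((σ g).snd)⁻¹ * ((σ h).snd)⁻¹ = f g h * ((σ (g * h)).snd)⁻¹
  rw [map_mul, ext_mul_snd, h1, h2]
  exact Units.ext (by push_cast; field_simp)

end IsCocycle

/-! ### The second cohomology group in terms of units. -/

section Cohomology

variable {G : Type} [Group G]

/-- The value `α(g, h)` of a cocycle, as a unit. -/
def TwoCocycle.unitVal (α : TwoCocycle ℂ G) (g h : G) : ℂˣ := Additive.toMul (α (g, h))

theorem TwoCocycle.val_eq (α : TwoCocycle ℂ G) (g h : G) : α.val g h = (α.unitVal g h : ℂ) := rfl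

theorem TwoCocycle.isCocycle (α : TwoCocycle ℂ G) : IsCocycle α.unitVal := fun g h j =>
  (groupCohomology.mem_cocycles₂_iff (A := unitsRep ℂ G) α).1 α.2 g h j

/-- The cocycle with given values. -/
def IsCocycle.toTwoCocycle {f : G → G → ℂˣ} (hf : IsCocycle f) : TwoCocycle ℂ G :=
  ⟨fun x => Additive.ofMul (f x.1 x.2),
    (groupCohomology.mem_cocycles₂_iff (A := unitsRep ℂ G) _).2 fun g h j => hf g h j⟩

@[simp] theorem IsCocycle.unitVal_toTwoCocycle {f : G → G → ℂˣ} (hf : IsCocycle f) (g h : G) :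
    hf.toTwoCocycle.unitVal g h = f g h := rfl

theorem TwoCocycle.ext_unitVal {α β : TwoCocycle ℂ G} (h : ∀ g j, α.unitVal g j = β.unitVal g j) :
    α = β :=
  groupCohomology.cocycles₂_ext h

theorem TwoCocycle.unitVal_sub (α β : TwoCocycle ℂ G) (g h : G) :
    (α - β).unitVal g h = α.unitVal g h / β.unitVal g h := rfl

theorem TwoCocycle.unitVal_zero (g h : G) : (0 : TwoCocycle ℂ G).unitVal g h = 1 := rfl

/-- `cohomologyClass` as a homomorphism. -/
noncomputable def cohomologyClassHom (G : Type) [Group G] :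
    TwoCocycle ℂ G →+ SecondCohomology ℂ G :=
  (groupCohomology.H2π (unitsRep ℂ G)).hom.toAddMonoidHom

theorem cohomologyClassHom_apply (α : TwoCocycle ℂ G) :
    cohomologyClassHom G α = cohomologyClass α := rfl

theorem cohomologyClassHom_surjective : Function.Surjective (cohomologyClassHom G) := fun x =>
  groupCohomology.H2_induction_on (C := fun x => ∃ a, cohomologyClassHom G a = x) x
    fun y => ⟨y, rfl⟩

theorem cohomologyClass_eq_zero_iff (α : TwoCocycle ℂ G) :
    cohomologyClass α = 0 ↔ ∃ c : G → ℂˣ, ∀ g h, c g * c h = α.unitVal g h * c (g * h) := by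
  refine (groupCohomology.H2π_eq_zero_iff (A := unitsRep ℂ G) α).trans ⟨?_, ?_⟩
  · rintro ⟨c, hc⟩
    refine ⟨fun g => Additive.toMul (c g), fun g h => ?_⟩
    have h1 : c h - c (g * h) + c g = α (g, h) := congrFun hc (g, h)
    have h2 : c g + c h = α (g, h) + c (g * h) := by rw [← h1]; abel
    exact h2
  · rintro ⟨c, hc⟩
    refine ⟨fun g => Additive.ofMul (c g), funext fun x => ?_⟩
    have h2 : Additive.ofMul (c x.1) + Additive.ofMul (c x.2) =
      (α x : Additive ℂˣ) + Additive.ofMul (c (x.1 * x.2)) := hc x.1 x.2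
    change Additive.ofMul (c x.2) - Additive.ofMul (c (x.1 * x.2)) + Additive.ofMul (c x.1) =
      (α x : Additive ℂˣ)
    rw [eq_sub_of_add_eq h2.symm]
    abel

theorem cohomologyClass_eq_iff (α β : TwoCocycle ℂ G) :
    cohomologyClass α = cohomologyClass β ↔
      ∃ c : G → ℂˣ, ∀ g h, c g * c h * β.unitVal g h = α.unitVal g h * c (g * h) := by
  rw [← sub_eq_zero, ← cohomologyClassHom_apply, ← cohomologyClassHom_apply, ← map_sub,
    cohomologyClassHom_apply, cohomologyClass_eq_zero_iff]
  refine exists_congr fun c => forall₂_congr fun g h => ?_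
  rw [TwoCocycle.unitVal_sub, div_mul_eq_mul_div, eq_div_iff_mul_eq']

/-- Two surjections onto abelian groups with the same kernel have isomorphic targets. -/
theorem exists_addEquiv_of_ker_eq {X A B : Type*} [AddCommGroup X] [AddCommGroup A]
    [AddCommGroup B] (f : X →+ A) (g : X →+ B) (hf : Function.Surjective f)
    (hg : Function.Surjective g) (h : ∀ x, f x = 0 ↔ g x = 0) : ∃ φ : A ≃+ B, ∀ x, φ (f x) = g x := by
  have hk : f.ker = g.ker := AddSubgroup.ext h
  let e := (QuotientAddGroup.quotientKerEquivOfSurjective f hf).symm.trans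
    ((QuotientAddGroup.quotientAddEquivOfEq hk).trans
      (QuotientAddGroup.quotientKerEquivOfSurjective g hg))
  refine ⟨e, fun x => ?_⟩
  have : (QuotientAddGroup.quotientKerEquivOfSurjective f hf).symm (f x) = (x : X ⧸ f.ker) := by
    rw [AddEquiv.symm_apply_eq]
    rfl
  change (QuotientAddGroup.quotientKerEquivOfSurjective g hg)
    ((QuotientAddGroup.quotientAddEquivOfEq hk)
      ((QuotientAddGroup.quotientKerEquivOfSurjective f hf).symm (f x))) = g x
  rw [this]
  rfl

end Cohomology

/-! ### Bases and isomorphisms of twisted group algebras. -/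

namespace TwistedGroupRing

variable {G H : Type} [Group G] [Group H]

/-- The basis element `ḡ`. -/
noncomputable def of (α : TwoCocycle ℂ G) (g : G) : TwistedGroupRing α :=
  (Finsupp.single g 1 : G →₀ ℂ)

/-- The identification of the twisted group algebra with the space of formal sums. -/
noncomputable def toFinsupp (α : TwoCocycle ℂ G) : TwistedGroupRing α ≃ₗ[ℂ] (G →₀ ℂ) :=
  LinearEquiv.refl ℂ (G →₀ ℂ)

/-- The standard basis of the twisted group algebra. -/
noncomputable def basis (α : TwoCocycle ℂ G) : Module.Basis G ℂ (TwistedGroupRing α) :=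
  ⟨toFinsupp α⟩

theorem basis_apply (α : TwoCocycle ℂ G) (g : G) : basis α g = of α g := rfl

theorem of_mul_of (α : TwoCocycle ℂ G) (g h : G) :
    of α g * of α h = (α.unitVal g h : ℂ) • of α (g * h) := by
  refine (twistedMul_single α g h 1 1).trans ?_
  rw [one_mul, one_mul, TwoCocycle.val_eq]
  change _ = (α.unitVal g h : ℂ) • (Finsupp.single (g * h) (1 : ℂ))
  rw [Finsupp.smul_single, smul_eq_mul, mul_one]

theorem of_one (α : TwoCocycle ℂ G) : of α 1 = (α.unitVal 1 1 : ℂ) • (1 : TwistedGroupRing α) := by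
  change Finsupp.single (1 : G) (1 : ℂ) = (α.unitVal 1 1 : ℂ) • (Finsupp.single 1 (α.invVal 1 1))
  rw [Finsupp.smul_single, smul_eq_mul]
  congr 1
  exact (Units.mul_inv _).symm

theorem mem_span_of (α : TwoCocycle ℂ G) (x : TwistedGroupRing α) :
    x ∈ Submodule.span ℂ (Set.range (of α)) := by
  have := (basis α).span_eq
  rw [show Set.range (basis α) = Set.range (of α) from rfl] at this
  rw [this]
  trivial

theorem finrank_eq (α : TwoCocycle ℂ G) :
    Module.finrank ℂ (TwistedGroupRing α) = Nat.card G :=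
  Module.finrank_eq_nat_card_basis (basis α)

/-- The algebra homomorphism determined by elements `U g` that multiply like the `ḡ`. -/
noncomputable def liftHom {A : Type*} [Ring A] [Algebra ℂ A] (α : TwoCocycle ℂ G) (U : G → A)
    (hone : U 1 = (α.unitVal 1 1 : ℂ) • (1 : A))
    (hmul : ∀ g h, U g * U h = (α.unitVal g h : ℂ) • U (g * h)) : TwistedGroupRing α →ₐ[ℂ] A :=
  AlgHom.ofLinearMap ((basis α).constr ℂ U)
    (by
      have h1 : (1 : TwistedGroupRing α) = (((α.unitVal 1 1)⁻¹ : ℂˣ) : ℂ) • basis α 1 := by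
        rw [basis_apply, of_one, smul_smul, Units.inv_mul, one_smul]
      rw [h1, map_smul, Module.Basis.constr_basis, hone, smul_smul, Units.inv_mul, one_smul])
    (by
      intro x y
      induction mem_span_of α x using Submodule.span_induction with
      | zero => simp
      | add x x' _ _ hx hx' => rw [add_mul, map_add, map_add, hx, hx', add_mul]
      | smul c x _ hx => rw [smul_mul_assoc, map_smul, map_smul, hx, smul_mul_assoc]
      | mem x h =>
        obtain ⟨g, rfl⟩ := h
        induction mem_span_of α y using Submodule.span_induction with
        | zero => simp
        | add x x' _ _ hx hx' => rw [mul_add, map_add, map_add, hx, hx', mul_add]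
        | smul c x _ hx => rw [mul_smul_comm, map_smul, map_smul, hx, mul_smul_comm]
        | mem y h =>
          obtain ⟨h, rfl⟩ := h
          rw [of_mul_of, map_smul, ← basis_apply, ← basis_apply,
            ← basis_apply, Module.Basis.constr_basis, Module.Basis.constr_basis,
            Module.Basis.constr_basis, hmul])

theorem liftHom_of {A : Type*} [Ring A] [Algebra ℂ A] (α : TwoCocycle ℂ G) (U : G → A)
    (hone : U 1 = (α.unitVal 1 1 : ℂ) • (1 : A))
    (hmul : ∀ g h, U g * U h = (α.unitVal g h : ℂ) • U (g * h)) (g : G) :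
    liftHom α U hone hmul (of α g) = U g :=
  (basis α).constr_basis ℂ U g

/-- Twisted group algebras of finite groups of the same order are isomorphic as soon as the second
is spanned by elements `U g` that multiply like the basis elements of the first. -/
theorem nonempty_algEquiv [Finite G] [Finite H] (hcard : Nat.card G = Nat.card H)
    (α : TwoCocycle ℂ G) (β : TwoCocycle ℂ H) (U : G → TwistedGroupRing β)
    (hmul : ∀ g h, U g * U h = (α.unitVal g h : ℂ) • U (g * h))
    (hspan : ∀ h, of β h ∈ Submodule.span ℂ (Set.range U)) :
    Nonempty (TwistedGroupRing α ≃ₐ[ℂ] TwistedGroupRing β) := by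
  have htop : ∀ x, x ∈ Submodule.span ℂ (Set.range U) := fun x =>
    Submodule.span_le.2 (Set.range_subset_iff.2 hspan) (mem_span_of β x)
  -- Because the `U g` span, `U 1` acts as a scalar; the condition on the identity thus follows from
  -- `hmul`.
  have hact : ∀ x, U 1 * x = (α.unitVal 1 1 : ℂ) • x := fun x => by
    induction htop x using Submodule.span_induction with
    | mem x h =>
      obtain ⟨g, rfl⟩ := h
      rw [hmul, one_mul, α.isCocycle.one_left]
    | zero => simp
    | add x y _ _ hx hy => rw [mul_add, hx, hy, smul_add]
    | smul c x _ hx => rw [mul_smul_comm, hx, smul_comm]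
  have hone : U 1 = (α.unitVal 1 1 : ℂ) • (1 : TwistedGroupRing β) := by rw [← hact, mul_one]
  let Φ := liftHom α U hone hmul
  have : Module.Finite ℂ (TwistedGroupRing α) := Module.Finite.of_basis (basis α)
  have : Module.Finite ℂ (TwistedGroupRing β) := Module.Finite.of_basis (basis β)
  have hsurj : Function.Surjective Φ.toLinearMap := by
    rw [← LinearMap.range_eq_top, eq_top_iff]
    intro x _
    refine Submodule.span_le.2 (Set.range_subset_iff.2 fun g => ?_) (htop x)
    exact ⟨of α g, liftHom_of α U hone hmul g⟩
  have hinj : Function.Injective Φ.toLinearMap :=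
    (LinearMap.injective_iff_surjective_of_finrank_eq_finrank
      (by rw [finrank_eq, finrank_eq, hcard])).2 hsurj
  exact ⟨AlgEquiv.ofBijective Φ ⟨hinj, hsurj⟩⟩

/-- Twisted group algebras of cohomologous cocycles are isomorphic. -/
theorem nonempty_algEquiv_of_class_eq [Finite G] {α β : TwoCocycle ℂ G}
    (h : cohomologyClass α = cohomologyClass β) :
    Nonempty (TwistedGroupRing α ≃ₐ[ℂ] TwistedGroupRing β) := by
  obtain ⟨c, hc⟩ := (cohomologyClass_eq_iff α β).1 h
  refine nonempty_algEquiv rfl α β (fun g => (c g : ℂ) • of β g) (fun g j => ?_) (fun g => ?_)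
  · rw [smul_mul_smul_comm, of_mul_of, smul_smul, smul_smul]
    congr 1
    exact_mod_cast congrArg Units.val (hc g j)
  · have h1 : of β g = (((c g)⁻¹ : ℂˣ) : ℂ) • ((c g : ℂ) • of β g) := by
      rw [smul_smul, Units.inv_mul, one_smul]
    rw [h1]
    exact Submodule.smul_mem _ _ (Submodule.subset_span ⟨g, rfl⟩)

end TwistedGroupRing

/-! ### Criteria for the relation between groups. -/

/-- Criterion for the relation: parametrize both cohomology groups by the same family of cocycles. -/
theorem twistedGroupRingRel_of_parametrization {G H : Type} [Group G] [Group H] [Finite G]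
    [Finite H] {X : Type*} [AddCommGroup X] (S : X →+ TwoCocycle ℂ G) (T : X →+ TwoCocycle ℂ H)
    (hS : ∀ α : TwoCocycle ℂ G, ∃ x, cohomologyClass (S x) = cohomologyClass α)
    (hT : ∀ β : TwoCocycle ℂ H, ∃ x, cohomologyClass (T x) = cohomologyClass β)
    (hker : ∀ x, cohomologyClass (S x) = 0 ↔ cohomologyClass (T x) = 0)
    (hiso : ∀ x, Nonempty (TwistedGroupRing (S x) ≃ₐ[ℂ] TwistedGroupRing (T x))) :
    TwistedGroupRingRel ℂ G H := by
  obtain ⟨φ, hφ⟩ := exists_addEquiv_of_ker_eq ((cohomologyClassHom G).comp S)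
    ((cohomologyClassHom H).comp T)
    (fun a => by
      obtain ⟨α, rfl⟩ := cohomologyClassHom_surjective a
      exact hS α)
    (fun b => by
      obtain ⟨β, rfl⟩ := cohomologyClassHom_surjective b
      exact hT β)
    hker
  refine ⟨φ, fun α β h => ?_⟩
  -- Arbitrary representatives are replaced by the cohomologous `S x` and `T x`.
  obtain ⟨x, hx⟩ := hS α
  have h1 : cohomologyClass (T x) = cohomologyClass β := by
    rw [← h, ← hx]
    exact (hφ x).symm
  obtain ⟨e₁⟩ := TwistedGroupRing.nonempty_algEquiv_of_class_eq hx
  obtain ⟨e₂⟩ := hiso x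
  obtain ⟨e₃⟩ := TwistedGroupRing.nonempty_algEquiv_of_class_eq h1
  exact ⟨(e₁.symm.trans e₂).trans e₃⟩

/-- Restriction of cocycles along a homomorphism. -/
def TwoCocycle.comap {G H : Type} [Group G] [Group H] (e : H →* G) :
    TwoCocycle ℂ G →+ TwoCocycle ℂ H where
  toFun α := IsCocycle.toTwoCocycle (f := fun g h => α.unitVal (e g) (e h)) fun g h j => by
    simp only [map_mul]
    exact α.isCocycle _ _ _
  map_zero' := rfl
  map_add' _ _ := rfl

theorem TwoCocycle.unitVal_comap {G H : Type} [Group G] [Group H] (e : H →* G)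
    (α : TwoCocycle ℂ G) (g h : H) :
    (TwoCocycle.comap e α).unitVal g h = α.unitVal (e g) (e h) := rfl

theorem twistedGroupRingRel_of_mulEquiv {G K : Type} [Group G] [Group K] [Finite G] (e : G ≃* K) :
    TwistedGroupRingRel ℂ G K := by
  have : Finite K := Finite.of_equiv G e
  refine twistedGroupRingRel_of_parametrization (AddMonoidHom.id _)
    (TwoCocycle.comap e.symm.toMonoidHom) (fun α => ⟨α, rfl⟩)
    (fun β => ⟨TwoCocycle.comap e.toMonoidHom β, ?_⟩) (fun α => ?_) (fun α => ?_)
  · congr 1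
    refine TwoCocycle.ext_unitVal fun g h => ?_
    simp [TwoCocycle.unitVal_comap]
  · rw [cohomologyClass_eq_zero_iff, cohomologyClass_eq_zero_iff]
    constructor
    · rintro ⟨c, hc⟩
      refine ⟨fun k => c (e.symm k), fun g h => ?_⟩
      have := hc (e.symm g) (e.symm h)
      rw [← map_mul] at this
      exact this
    · rintro ⟨c, hc⟩
      refine ⟨fun k => c (e k), fun g h => ?_⟩
      have := hc (e g) (e h)
      rw [← map_mul, TwoCocycle.unitVal_comap] at this
      simpa using this
  · refine TwistedGroupRing.nonempty_algEquiv (Nat.card_congr e.toEquiv) _ _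
      (fun g => TwistedGroupRing.of _ (e g)) (fun g h => ?_) (fun k => ?_)
    · rw [TwistedGroupRing.of_mul_of, TwoCocycle.unitVal_comap, map_mul]
      simp
    · exact Submodule.subset_span ⟨e.symm k, by simp⟩

/-! ### Alternating bilinear forms. -/

section Symplectic

variable {K V V' : Type} [Field K] [AddCommGroup V] [Module K V] [AddCommGroup V'] [Module K V']

/-- The orthogonal complement of a hyperbolic pair. -/
def hyperbolicCompl (B : LinearMap.BilinForm K V) (a b : V) : Submodule K V :=
  LinearMap.ker (LinearMap.flip B a) ⊓ LinearMap.ker (LinearMap.flip B b)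

theorem mem_hyperbolicCompl {B : LinearMap.BilinForm K V} {a b x : V} :
    x ∈ hyperbolicCompl B a b ↔ B x a = 0 ∧ B x b = 0 := Iff.rfl

theorem apply_eq_neg_one {B : LinearMap.BilinForm K V} (hB : B.IsAlt) {a b : V}
    (hab : B a b = 1) : B b a = -1 := by
  rw [← hab, hB.neg_eq]

/-- The projection onto the orthogonal complement of a hyperbolic pair. -/
def hyperbolicProj (B : LinearMap.BilinForm K V) (hB : B.IsAlt) {a b : V} (hab : B a b = 1) :
    V →ₗ[K] hyperbolicCompl B a b :=
  LinearMap.codRestrict _ (LinearMap.id - (LinearMap.flip B b).smulRight a +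
    (LinearMap.flip B a).smulRight b) fun x => by
      rw [mem_hyperbolicCompl]
      simp [hab, apply_eq_neg_one hB hab, hB.self_eq_zero]

theorem coe_hyperbolicProj (B : LinearMap.BilinForm K V) (hB : B.IsAlt) {a b : V}
    (hab : B a b = 1) (x : V) :
    (hyperbolicProj B hB hab x : V) = x - B x b • a + B x a • b := rfl

theorem hyperbolicProj_of_mem (B : LinearMap.BilinForm K V) (hB : B.IsAlt) {a b : V}
    (hab : B a b = 1) (s t : K) (w : hyperbolicCompl B a b) :
    hyperbolicProj B hB hab (s • a + t • b + w) = w := by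
  have hw := mem_hyperbolicCompl.1 w.2
  have hba := apply_eq_neg_one hB hab
  refine Subtype.ext ?_
  rw [coe_hyperbolicProj]
  simp only [map_add, map_smul, LinearMap.add_apply, LinearMap.smul_apply, hab, hba,
    hB.self_eq_zero, hw.1, hw.2, smul_eq_mul, mul_one, mul_zero, add_zero, zero_add, mul_neg,
    neg_smul]
  abel

/-- Splitting off a hyperbolic plane from an alternating form. -/
def hyperbolicSplit (B : LinearMap.BilinForm K V) (hB : B.IsAlt) {a b : V} (hab : B a b = 1) :
    V ≃ₗ[K] (K × K) × hyperbolicCompl B a b :=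
  { ((LinearMap.flip B b).prod (-(LinearMap.flip B a))).prod (hyperbolicProj B hB hab) with
    invFun := fun y => y.1.1 • a + y.1.2 • b + y.2
    left_inv := fun x => by
      change B x b • a + (-B x a) • b + (x - B x b • a + B x a • b) = x
      rw [neg_smul]
      abel
    right_inv := fun y => by
      obtain ⟨⟨s, t⟩, w⟩ := y
      have hw := mem_hyperbolicCompl.1 w.2
      refine Prod.ext (Prod.ext ?_ ?_) (hyperbolicProj_of_mem B hB hab s t w)
      · change B (s • a + t • b + w) b = s
        simp [hab, hB.self_eq_zero, hw.2]
      · change -B (s • a + t • b + w) a = t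
        simp [apply_eq_neg_one hB hab, hB.self_eq_zero, hw.1] }

/-- The splitting is orthogonal, so isometries can be built one hyperbolic plane at a time. -/
theorem hyperbolicSplit_form (B : LinearMap.BilinForm K V) (hB : B.IsAlt) {a b : V}
    (hab : B a b = 1) (x y : V) :
    B x y = (hyperbolicSplit B hB hab x).1.1 * (hyperbolicSplit B hB hab y).1.2 -
      (hyperbolicSplit B hB hab x).1.2 * (hyperbolicSplit B hB hab y).1.1 +
      B (hyperbolicSplit B hB hab x).2 (hyperbolicSplit B hB hab y).2 := by
  have hba := apply_eq_neg_one hB hab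
  have h1 : B a y = - B y a := (hB.neg_eq _ _).symm
  have h2 : B b y = - B y b := (hB.neg_eq _ _).symm
  change B x y = B x b * -B y a - -B x a * B y b +
    B (x - B x b • a + B x a • b) (y - B y b • a + B y a • b)
  simp only [map_add, map_sub, map_smul, LinearMap.add_apply, LinearMap.sub_apply,
    LinearMap.smul_apply, smul_eq_mul, hab, hba, h1, h2, hB.self_eq_zero]
  ring

theorem exists_hyperbolic_pair (B : LinearMap.BilinForm K V)
    (hn : ∀ u, (∀ v, B u v = 0) → u = 0) (hV : Module.finrank K V ≠ 0) :
    ∃ a b, B a b = 1 := by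
  have : Nontrivial V := Module.nontrivial_of_finrank_pos (R := K) (Nat.pos_of_ne_zero hV)
  obtain ⟨a, ha⟩ := exists_ne (0 : V)
  have h1 : ∃ v, B a v ≠ 0 := by
    by_contra! h
    exact ha (hn a h)
  obtain ⟨v, hv⟩ := h1
  exact ⟨a, (B a v)⁻¹ • v, by rw [map_smul, smul_eq_mul, inv_mul_cancel₀ hv]⟩

/-- A vector of the complement pairs to zero with `a` and `b`, so only the projection of a test
vector to the complement matters. -/
theorem hyperbolicCompl_nondegenerate (B : LinearMap.BilinForm K V) (hB : B.IsAlt)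
    (hn : ∀ u, (∀ v, B u v = 0) → u = 0) {a b : V} (hab : B a b = 1)
    (u : hyperbolicCompl B a b) (hu : ∀ v, B.restrict (hyperbolicCompl B a b) u v = 0) : u = 0 := by
  refine Subtype.ext (hn u fun v => ?_)
  have h := mem_hyperbolicCompl.1 u.2
  have h3 := hu (hyperbolicSplit B hB hab v).2
  change B u (v - B v b • a + B v a • b) = 0 at h3
  simpa [h.1, h.2] using h3

/-- Nondegenerate alternating forms of the same finite dimension are isometric. -/
theorem exists_isometry_of_finrank_eq (n : ℕ) : ∀ {V V' : Type} [AddCommGroup V] [Module K V]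
    [AddCommGroup V'] [Module K V'] [FiniteDimensional K V] [FiniteDimensional K V']
    (B : LinearMap.BilinForm K V) (B' : LinearMap.BilinForm K V') (_ : B.IsAlt) (_ : B'.IsAlt)
    (_ : ∀ u, (∀ v, B u v = 0) → u = 0) (_ : ∀ u, (∀ v, B' u v = 0) → u = 0)
    (_ : Module.finrank K V = n) (_ : Module.finrank K V' = n),
    ∃ e : V ≃ₗ[K] V', ∀ u v, B' (e u) (e v) = B u v := by
  induction n using Nat.strong_induction_on with
  | _ n ih =>
    intro V V' _ _ _ _ _ _ B B' hB hB' hn hn' hV hV'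
    rcases Nat.eq_zero_or_pos n with rfl | hpos
    · have := Module.finrank_zero_iff.1 hV
      refine ⟨LinearEquiv.ofFinrankEq V V' (hV.trans hV'.symm), fun u v => ?_⟩
      rw [Subsingleton.elim u 0]
      simp
    · obtain ⟨a, b, hab⟩ := exists_hyperbolic_pair B hn (by omega)
      obtain ⟨a', b', hab'⟩ := exists_hyperbolic_pair B' hn' (by omega)
      -- Both dimensions drop by two; in particular dimension one cannot occur.
      have h1 := (hyperbolicSplit B hB hab).finrank_eq
      have h2 := (hyperbolicSplit B' hB' hab').finrank_eq
      simp only [Module.finrank_prod, Module.finrank_self] at h1 h2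
      obtain ⟨e, he⟩ := ih (n - 2) (by omega) (B.restrict (hyperbolicCompl B a b))
        (B'.restrict (hyperbolicCompl B' a' b')) (fun x => hB x) (fun x => hB' x)
        (hyperbolicCompl_nondegenerate B hB hn hab)
        (hyperbolicCompl_nondegenerate B' hB' hn' hab') (by omega) (by omega)
      refine ⟨(hyperbolicSplit B hB hab).trans (((LinearEquiv.refl K (K × K)).prodCongr e).trans
        (hyperbolicSplit B' hB' hab').symm), fun u v => ?_⟩
      rw [hyperbolicSplit_form B' hB' hab', hyperbolicSplit_form B hB hab u v]
      simp only [LinearEquiv.trans_apply, LinearEquiv.apply_symm_apply]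
      congr 1
      exact he _ _

/-- In dimension at least three, the orthogonal of a vector is not totally isotropic. -/
theorem exists_orthogonal_pair [FiniteDimensional K V] (B : LinearMap.BilinForm K V)
    (hB : B.IsAlt) (hn : ∀ u, (∀ v, B u v = 0) → u = 0) (hV : 3 ≤ Module.finrank K V) (x : V) :
    ∃ a b, B a x = 0 ∧ B b x = 0 ∧ B a b ≠ 0 := by
  by_contra! hcon
  by_cases hx : x = 0
  · obtain ⟨a, b, hab⟩ := exists_hyperbolic_pair B hn (by omega)
    have := hcon a b (by simp [hx]) (by simp [hx])
    exact one_ne_zero (hab.symm.trans this)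
  · obtain ⟨y, hy⟩ : ∃ y, B x y = 1 := by
      have h1 : ∃ v, B x v ≠ 0 := by
        by_contra! h
        exact hx (hn x h)
      obtain ⟨v, hv⟩ := h1
      exact ⟨(B x v)⁻¹ • v, by rw [map_smul, smul_eq_mul, inv_mul_cancel₀ hv]⟩
    -- The complement of the plane of `x` and `y` is orthogonal to `x`, nondegenerate and of
    -- positive dimension.
    have h2 := (hyperbolicSplit B hB hy).finrank_eq
    simp only [Module.finrank_prod, Module.finrank_self] at h2
    obtain ⟨a, b, hab⟩ := exists_hyperbolic_pair (B.restrict (hyperbolicCompl B x y))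
      (hyperbolicCompl_nondegenerate B hB hn hy) (by omega)
    have := hcon a b (mem_hyperbolicCompl.1 a.2).1 (mem_hyperbolicCompl.1 b.2).1
    exact one_ne_zero (hab.symm.trans this)

/-- Every alternating form is the antisymmetrization of a bilinear form. -/
theorem exists_sub_flip_eq [FiniteDimensional K V] (B : LinearMap.BilinForm K V) (hB : B.IsAlt) :
    ∃ b : LinearMap.BilinForm K V, ∀ u v, b u v - b v u = B u v := by
  let n := Module.finrank K V
  let v : Module.Basis (Fin n) K V := Module.finBasis K V
  -- The strictly upper triangular part of the Gram matrix, which works in characteristic 2 as well,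
  -- unlike B/2.
  let b : LinearMap.BilinForm K V :=
    v.constr K fun i => v.constr K fun j => if i < j then B (v i) (v j) else 0
  refine ⟨b, fun x y => ?_⟩
  have hbv : ∀ i j, b (v i) (v j) = if i < j then B (v i) (v j) else 0 := fun i j => by
    simp only [b, Module.Basis.constr_basis]
  have hb : b - LinearMap.flip b = B := by
    refine v.ext fun i => v.ext fun j => ?_
    rw [LinearMap.sub_apply, LinearMap.sub_apply, LinearMap.flip_apply, hbv, hbv]
    rcases lt_trichotomy i j with h | h | h
    · rw [if_pos h, if_neg h.not_gt, sub_zero]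
    · subst h
      simp [hB.self_eq_zero]
    · rw [if_pos h, if_neg h.not_gt, zero_sub, hB.neg_eq]
  rw [← hb]
  rfl

end Symplectic

/-! ### Extra-special groups as central extensions of symplectic spaces. -/

/-- A central extension of an `𝔽_p`-space `V` by `𝔽_p` whose commutator form is `B`. -/
structure SymplecticCover (p : ℕ) {V : Type} [AddCommGroup V] [Module (ZMod p) V]
    (B : LinearMap.BilinForm (ZMod p) V) (G : Type) [Group G] where
  proj : G →* Multiplicative V
  incl : Multiplicative (ZMod p) →* G
  proj_surjective : Function.Surjective proj
  incl_injective : Function.Injective incl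
  ker_proj : proj.ker = incl.range
  commutator_eq : ∀ g h,
    ⁅g, h⁆ = incl (Multiplicative.ofAdd (B (proj g).toAdd (proj h).toAdd))

namespace SymplecticCover

variable {p : ℕ} {V : Type} [AddCommGroup V] [Module (ZMod p) V]
  {B : LinearMap.BilinForm (ZMod p) V} {G : Type} [Group G]

/-- Transport of a cover along an isometry. -/
def ofIsometry {V' : Type} [AddCommGroup V'] [Module (ZMod p) V']
    {B' : LinearMap.BilinForm (ZMod p) V'} (C : SymplecticCover p B G) (e : V ≃ₗ[ZMod p] V')
    (he : ∀ u v, B' (e u) (e v) = B u v) : SymplecticCover p B' G where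
  proj := e.toAddEquiv.toMultiplicative.toMonoidHom.comp C.proj
  incl := C.incl
  proj_surjective := e.toAddEquiv.toMultiplicative.surjective.comp C.proj_surjective
  incl_injective := C.incl_injective
  ker_proj := by
    rw [← C.ker_proj]
    ext g
    exact e.toAddEquiv.toMultiplicative.map_eq_one_iff
  commutator_eq g h := by
    rw [C.commutator_eq, ← he]
    rfl

variable (C : SymplecticCover p B G)

theorem proj_incl (k : Multiplicative (ZMod p)) : C.proj (C.incl k) = 1 := by
  rw [← MonoidHom.mem_ker, C.ker_proj]
  exact ⟨k, rfl⟩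

theorem exists_incl_eq {g : G} (hg : C.proj g = 1) : ∃ k, C.incl k = g := by
  rw [← MonoidHom.mem_ker, C.ker_proj] at hg
  exact hg

/-- Commutators depend only on images in `V`, so the kernel is automatically central. -/
theorem incl_commute (k : Multiplicative (ZMod p)) (g : G) : Commute (C.incl k) g := by
  rw [← commutatorElement_eq_one_iff_commute, C.commutator_eq, C.proj_incl]
  simp

theorem natCard_eq [NeZero p] (C : SymplecticCover p B G) : Nat.card G = p * Nat.card V := by
  have h1 : Nat.card (Multiplicative V) = Nat.card V := rfl
  have h2 : Nat.card (Multiplicative (ZMod p)) = p := by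
    exact (Nat.card_congr Multiplicative.toAdd).trans (Nat.card_zmod p)
  rw [← Subgroup.card_mul_index C.proj.ker, Subgroup.index_ker, C.ker_proj,
    MonoidHom.range_eq_top.2 C.proj_surjective, Subgroup.card_top, h1,
    ← Nat.card_congr (MonoidHom.ofInjective C.incl_injective).toEquiv, h2]

end SymplecticCover

section ClassTwo

variable {G : Type} [Group G]

theorem commutatorElement_mul_left_of_central (hG : ∀ g h x : G, Commute ⁅g, h⁆ x)
    (g g' h : G) : ⁅g * g', h⁆ = ⁅g, h⁆ * ⁅g', h⁆ := by
  rw [commutatorElement_mul_left_eq_conj_mul, ← (hG g' h g).eq, mul_inv_cancel_right,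
    (hG g' h _).eq]

theorem commutatorElement_mul_right_of_central (hG : ∀ g h x : G, Commute ⁅g, h⁆ x)
    (g h h' : G) : ⁅g, h * h'⁆ = ⁅g, h⁆ * ⁅g, h'⁆ := by
  rw [commutatorElement_mul_right_eq_mul_conj, mul_assoc ⁅g, h⁆, ← (hG g h' h).eq, ← mul_assoc,
    mul_inv_cancel_right]

theorem commutatorElement_pow_left_of_central (hG : ∀ g h x : G, Commute ⁅g, h⁆ x)
    (g h : G) (n : ℕ) : ⁅g ^ n, h⁆ = ⁅g, h⁆ ^ n :=
  map_pow (MonoidHom.mk' (fun g => ⁅g, h⁆) fun g g' =>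
    commutatorElement_mul_left_of_central hG g g' h) g n

end ClassTwo

/-- An abelian group killed by p is an 𝔽_p-space, and biadditive maps on it with values in ℤ/p are
automatically bilinear. -/
theorem exists_symplecticCover_of_addMonoidHom {p : ℕ} {G A : Type} [Group G] [AddCommGroup A]
    (hp : ∀ x : A, p • x = 0) (b : A →+ A →+ ZMod p) (halt : ∀ u, b u u = 0)
    (hnd : ∀ u, (∀ v, b u v = 0) → u = 0) (π : G →* Multiplicative A)
    (ι : Multiplicative (ZMod p) →* G) (hπ : Function.Surjective π) (hι : Function.Injective ι)
    (hker : π.ker = ι.range)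
    (hcomm : ∀ g h, ⁅g, h⁆ = ι (Multiplicative.ofAdd (b (π g).toAdd (π h).toAdd))) :
    ∃ (V : Type) (_ : AddCommGroup V) (_ : Module (ZMod p) V)
      (B : LinearMap.BilinForm (ZMod p) V), B.IsAlt ∧ (∀ u, (∀ v, B u v = 0) → u = 0) ∧
        Nonempty (SymplecticCover p B G) := by
  let _ : Module (ZMod p) A := AddCommGroup.zmodModule hp
  let B : LinearMap.BilinForm (ZMod p) A :=
    LinearMap.mk₂ (ZMod p) (fun u v => b u v) (fun u v w => by simp)
      (fun c u v => ZMod.map_smul (b.flip v) c u) (fun u v w => by simp)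
      (fun c u v => ZMod.map_smul (b u) c v)
  exact ⟨A, _, _, B, halt, hnd, ⟨⟨π, ι, hπ, hι, hker, hcomm⟩⟩⟩

/-- `V` is the central quotient, realized as the abelianization because the centre is the derived
subgroup. The commutator pairing is nondegenerate since its radical in `G` is the centre. -/
theorem IsExtraSpecial.exists_symplecticCover {p : ℕ} [Fact p.Prime] {G : Type} [Group G]
    (hG : IsExtraSpecial p G) :
    ∃ (V : Type) (_ : AddCommGroup V) (_ : Module (ZMod p) V)
      (B : LinearMap.BilinForm (ZMod p) V), B.IsAlt ∧ (∀ u, (∀ v, B u v = 0) → u = 0) ∧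
        Nonempty (SymplecticCover p B G) := by
  have hmem : ∀ g h : G, ⁅g, h⁆ ∈ Subgroup.center G := fun g h => by
    rw [hG.center_eq_commutator]
    exact Subgroup.commutator_mem_commutator (Subgroup.mem_top _) (Subgroup.mem_top _)
  have hcent : ∀ g h x : G, Commute ⁅g, h⁆ x := fun g h x =>
    (Subgroup.mem_center_iff.1 (hmem g h) x).symm
  let z : Subgroup.center G ≃* Multiplicative (ZMod p) :=
    mulEquivOfPrimeCardEq (p := p) hG.card_center (by simp)
  -- The pairing descends to the abelianization one variable at a time, first the second and then
  -- the first.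
  let b₀ : G → G →* Multiplicative (ZMod p) := fun g =>
    MonoidHom.mk' (fun h => z ⟨⁅g, h⁆, hmem g h⟩) fun h h' => by
      rw [← map_mul]
      exact congrArg z (Subtype.ext (commutatorElement_mul_right_of_central hcent g h h'))
  let b₁ : G →* Abelianization G →* Multiplicative (ZMod p) :=
    MonoidHom.mk' (fun g => Abelianization.lift (b₀ g)) fun g g' => by
      refine Abelianization.hom_ext _ _ (MonoidHom.ext fun h => ?_)
      change z _ = z _ * z _
      rw [← map_mul]
      exact congrArg z (Subtype.ext (commutatorElement_mul_left_of_central hcent g g' h))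
  let b₂ : Abelianization G →* Abelianization G →* Multiplicative (ZMod p) :=
    Abelianization.lift b₁
  have hp : ∀ x : Additive (Abelianization G), p • x = 0 := fun x => by
    obtain ⟨g, hg⟩ := QuotientGroup.mk_surjective (x.toMul)
    change Additive.ofMul (x.toMul ^ p) = 0
    rw [← hg, ofMul_eq_zero]
    refine (QuotientGroup.eq_one_iff (g ^ p)).2 ?_
    rw [← hG.center_eq_commutator]
    exact hG.pow_mem_center g
  let b₃ : Additive (Abelianization G) →+ Additive (Abelianization G) →+ ZMod p :=
    AddMonoidHom.mk' (fun u => MonoidHom.toAdditiveLeft (b₂ u.toMul)) fun u v => by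
      rw [toMul_add, map_mul]
      rfl
  have hb : ∀ g h : G, b₃ (Additive.ofMul (Abelianization.of g))
      (Additive.ofMul (Abelianization.of h)) = (z ⟨⁅g, h⁆, hmem g h⟩).toAdd := fun g h => rfl
  refine exists_symplecticCover_of_addMonoidHom hp b₃ ?_ ?_ Abelianization.of
    ((Subgroup.center G).subtype.comp z.symm.toMonoidHom) QuotientGroup.mk_surjective ?_ ?_ ?_
  · intro u
    obtain ⟨g, rfl⟩ := QuotientGroup.mk_surjective u
    have h1 := hb g g
    have h2 : (⟨⁅g, g⁆, hmem g g⟩ : Subgroup.center G) = 1 := Subtype.ext (commutatorElement_self g)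
    rw [h2, map_one] at h1
    exact h1
  · intro u hu
    obtain ⟨g, rfl⟩ := QuotientGroup.mk_surjective u
    change Additive.ofMul (QuotientGroup.mk g : Abelianization G) = 0
    rw [ofMul_eq_zero, QuotientGroup.eq_one_iff, ← hG.center_eq_commutator,
      Subgroup.mem_center_iff]
    intro h
    have h1 := (hb g h).symm.trans (hu _)
    rw [toAdd_eq_zero, map_eq_one_iff z z.injective] at h1
    exact (commutatorElement_eq_one_iff_commute.1 (congrArg Subtype.val h1)).symm
  · exact (Subgroup.center G).subtype_injective.comp z.symm.injective
  · rw [MonoidHom.range_comp, MonoidHom.range_eq_top.2 z.symm.surjective,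
      ← MonoidHom.range_eq_map, Subgroup.range_subtype, hG.center_eq_commutator]
    exact Abelianization.ker_of G
  · intro g h
    change ⁅g, h⁆ = (z.symm (z ⟨⁅g, h⁆, hmem g h⟩) : Subgroup.center G)
    rw [z.symm_apply_apply]

/-! ### Characters of ℤ/p and bilinear forms. -/

section StdChar

variable (p : ℕ) [Fact p.Prime]

/-- The second clause provides logarithms in ℤ/p for p-th roots of unity. -/
theorem exists_faithful_char : ∃ e : Multiplicative (ZMod p) →* ℂˣ,
    Function.Injective e ∧ ∀ m : ℂˣ, m ^ p = 1 → ∃ k, e k = m := by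
  have hp0 : p ≠ 0 := (Fact.out : p.Prime).ne_zero
  have hζ := (Complex.isPrimitiveRoot_exp p hp0).isUnit_unit' hp0
  set ζ := ((Complex.isPrimitiveRoot_exp p hp0).isUnit hp0).unit' with hζdef
  refine ⟨(Subgroup.zpowers ζ).subtype.comp
    (AddMonoidHom.toMultiplicativeLeft hζ.zmodEquivZPowers.toAddMonoidHom),
    (Subgroup.zpowers ζ).subtype_injective.comp hζ.zmodEquivZPowers.injective, fun m hm => ?_⟩
  have : m ∈ Subgroup.zpowers ζ := by
    obtain ⟨i, _, hi⟩ := (Complex.isPrimitiveRoot_exp p hp0).eq_pow_of_pow_eq_one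
      (ξ := (m : ℂ)) (by rw [← Units.val_pow_eq_pow_val, hm, Units.val_one])
    refine ⟨i, Units.ext ?_⟩
    rw [← hi]
    simp [ζ]
  exact ⟨Multiplicative.ofAdd (hζ.zmodEquivZPowers.symm (Additive.ofMul ⟨m, this⟩)),
    congrArg Subtype.val (hζ.zmodEquivZPowers.apply_symm_apply (Additive.ofMul ⟨m, this⟩))⟩

/-- A faithful character `k ↦ ζ ^ k` of `ℤ/p`, written additively in the argument. -/
noncomputable def stdChar (k : ZMod p) : ℂˣ :=
  Classical.choose (exists_faithful_char p) (Multiplicative.ofAdd k)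

variable {p}

theorem stdChar_add (k l : ZMod p) : stdChar p (k + l) = stdChar p k * stdChar p l :=
  map_mul (Classical.choose (exists_faithful_char p)) _ _

@[simp] theorem stdChar_zero : stdChar p 0 = 1 :=
  map_one (Classical.choose (exists_faithful_char p))

theorem stdChar_sub (k l : ZMod p) : stdChar p (k - l) = stdChar p k / stdChar p l :=
  map_div (Classical.choose (exists_faithful_char p)) _ _

theorem stdChar_nsmul (n : ℕ) (k : ZMod p) : stdChar p (n • k) = stdChar p k ^ n :=
  map_pow (Classical.choose (exists_faithful_char p)) _ _

theorem stdChar_injective : Function.Injective (stdChar p) :=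
  (Classical.choose_spec (exists_faithful_char p)).1.comp Multiplicative.ofAdd.injective

theorem exists_stdChar_eq {m : ℂˣ} (hm : m ^ p = 1) : ∃ k, stdChar p k = m := by
  obtain ⟨k, hk⟩ := (Classical.choose_spec (exists_faithful_char p)).2 m hm
  exact ⟨k.toAdd, hk⟩

/-- Every character of `ℤ/p` is a power of the standard one. -/
theorem exists_eq_stdChar_mul (χ : Multiplicative (ZMod p) →* ℂˣ) :
    ∃ k : ZMod p, ∀ m : ZMod p, χ (Multiplicative.ofAdd m) = stdChar p (k * m) := by
  have h1 : ∀ m : ZMod p, χ (Multiplicative.ofAdd m) = χ (Multiplicative.ofAdd 1) ^ m.val := by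
    intro m
    rw [← map_pow, ← ofAdd_nsmul, nsmul_one, ZMod.natCast_zmod_val]
  obtain ⟨k, hk⟩ := exists_stdChar_eq (p := p) (m := χ (Multiplicative.ofAdd 1)) (by
    rw [← map_pow, ← ofAdd_nsmul, nsmul_one, CharP.cast_eq_zero, ofAdd_zero, map_one])
  refine ⟨k, fun m => ?_⟩
  rw [h1, ← hk, ← stdChar_nsmul, nsmul_eq_mul, ZMod.natCast_zmod_val, mul_comm]

/-- A bimultiplicative map trivial on the kernel of `q` comes from a bilinear form. -/
theorem exists_bilinForm_of_bimultiplicative {V E : Type} [AddCommGroup V] [Module (ZMod p) V]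
    [Group E] (q : E →* Multiplicative V) (hq : Function.Surjective q) (A : E → E → ℂˣ)
    (hl : ∀ x x' y, A (x * x') y = A x y * A x' y) (hr : ∀ x y y', A x (y * y') = A x y * A x y')
    (hkl : ∀ x y, q x = 1 → A x y = 1) (hkr : ∀ x y, q y = 1 → A x y = 1) :
    ∃ a : LinearMap.BilinForm (ZMod p) V,
      ∀ x y, A x y = stdChar p (a (q x).toAdd (q y).toAdd) := by
  have hcong : ∀ x x' y y', q x = q x' → q y = q y' → A x y = A x' y' := by
    intro x x' y y' hx hy
    have h1 : A x y = A x' y := by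
      have : A (x * x'⁻¹ * x') y = A (x * x'⁻¹) y * A x' y := hl _ _ _
      rwa [inv_mul_cancel_right, hkl (x * x'⁻¹) y (by rw [map_mul, map_inv, hx, mul_inv_cancel]),
        one_mul] at this
    have h2 : A x' y = A x' y' := by
      have : A x' (y * y'⁻¹ * y') = A x' (y * y'⁻¹) * A x' y' := hr _ _ _
      rwa [inv_mul_cancel_right, hkr x' (y * y'⁻¹) (by rw [map_mul, map_inv, hy, mul_inv_cancel]),
        one_mul] at this
    rw [h1, h2]
  -- `V` is killed by p, so the values of `A` are p-th roots of unity and have logarithms.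
  have hpow : ∀ x y, A x y ^ p = 1 := by
    intro x y
    refine (map_pow (MonoidHom.mk' (fun x => A x y) fun x x' => hl x x' y) x p).symm.trans ?_
    refine hkl _ _ ?_
    rw [map_pow]
    change p • (q x).toAdd = 0
    rw [← Nat.cast_smul_eq_nsmul (ZMod p), CharP.cast_eq_zero, zero_smul]
  choose L hL using fun x y => exists_stdChar_eq (hpow x y)
  choose s hs using hq
  let s' : V → E := fun v => s (Multiplicative.ofAdd v)
  have hs' : ∀ v, q (s' v) = Multiplicative.ofAdd v := fun v => hs _
  let a₀ : V →+ V →+ ZMod p := AddMonoidHom.mk' (fun u => AddMonoidHom.mk'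
    (fun v => L (s' u) (s' v)) fun v w => stdChar_injective (by
      rw [stdChar_add, hL, hL, hL, ← hr]
      exact hcong _ _ _ _ rfl (by rw [map_mul, hs', hs', hs', ofAdd_add])))
    fun u v => AddMonoidHom.ext fun w => stdChar_injective (by
      change stdChar p (L (s' (u + v)) (s' w)) = stdChar p (L (s' u) (s' w) + L (s' v) (s' w))
      rw [stdChar_add, hL, hL, hL, ← hl]
      exact hcong _ _ _ _ (by rw [map_mul, hs', hs', hs', ofAdd_add]) rfl)
  let a : LinearMap.BilinForm (ZMod p) V :=
    LinearMap.mk₂ (ZMod p) (fun u v => a₀ u v) (fun u v w => by simp)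
      (fun c u v => ZMod.map_smul (a₀.flip v) c u) (fun u v w => by simp)
      (fun c u v => ZMod.map_smul (a₀ u) c v)
  refine ⟨a, fun x y => ?_⟩
  change A x y = stdChar p (L (s' (q x).toAdd) (s' (q y).toAdd))
  rw [hL]
  exact hcong _ _ _ _ (hs' _).symm (hs' _).symm

end StdChar

/-- An injection of `ℂˣ` into a commutative group splits. -/
theorem exists_retraction {E : Type} [Group E] (hE : ∀ x y : E, x * y = y * x) (j : ℂˣ →* E)
    (hj : Function.Injective j) : ∃ ρ : E →* ℂˣ, ∀ m, ρ (j m) = m := by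
  obtain ⟨ρ, hρ⟩ := exists_monoidHom_extension j.range (MonoidHom.ofInjective hj).symm.toMonoidHom
    (fun x hx => by
      have : commutator E = ⊥ := by
        rw [commutator_eq_bot_iff_center_eq_top, eq_top_iff]
        exact fun x _ => Subgroup.mem_center_iff.2 fun y => hE y x
      rw [this, Subgroup.mem_bot] at hx
      rw [show x = 1 from Subtype.ext hx, map_one])
  refine ⟨ρ, fun m => ?_⟩
  refine (hρ ⟨j m, m, rfl⟩).trans ?_
  exact (MonoidHom.ofInjective hj).symm_apply_apply m

/-! ### Cohomology classes given by bilinear forms on `V`. -/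

namespace SymplecticCover

variable {p : ℕ} [Fact p.Prime] {V : Type} [AddCommGroup V] [Module (ZMod p) V]
  {B : LinearMap.BilinForm (ZMod p) V} {G : Type} [Group G] (C : SymplecticCover p B G)

/-- The projection onto `V`, written additively. -/
def vec (g : G) : V := (C.proj g).toAdd

theorem vec_mul (g h : G) : C.vec (g * h) = C.vec g + C.vec h := by
  rw [vec, map_mul]
  rfl

theorem vec_eq_zero_iff {g : G} : C.vec g = 0 ↔ C.proj g = 1 := Iff.rfl

@[simp] theorem vec_incl (k : Multiplicative (ZMod p)) : C.vec (C.incl k) = 0 := C.proj_incl k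

theorem vec_commutator (g h : G) : C.vec ⁅g, h⁆ = 0 := by rw [C.commutator_eq, vec_incl]

theorem exists_vec_eq (v : V) : ∃ g, C.vec g = v := C.proj_surjective (Multiplicative.ofAdd v)

/-- The cocycle `(g, h) ↦ ζ ^ b(g, h)` attached to a bilinear form `b` on `V`. -/
noncomputable def cocycle : LinearMap.BilinForm (ZMod p) V →+ TwoCocycle ℂ G where
  toFun b := IsCocycle.toTwoCocycle (f := fun g h => stdChar p (b (C.vec g) (C.vec h)))
    fun g h j => by
      rw [← stdChar_add, ← stdChar_add]
      congr 1
      simp only [vec_mul, map_add, LinearMap.add_apply]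
      abel
  map_zero' := TwoCocycle.ext_unitVal fun g h => stdChar_zero
  map_add' b b' := TwoCocycle.ext_unitVal fun g h => stdChar_add _ _

theorem unitVal_cocycle (b : LinearMap.BilinForm (ZMod p) V) (g h : G) :
    (C.cocycle b).unitVal g h = stdChar p (b (C.vec g) (C.vec h)) := rfl

/-- A trivializing cochain restricts to a character of the central ℤ/p; comparing its values at gh
and hg = [g,h]⁻¹gh makes b - bᵗ a multiple of B. Conversely, such a multiple gives a character of
ℤ/p to which `exists_coboundary` applies. -/
theorem class_cocycle_eq_zero_iff (b : LinearMap.BilinForm (ZMod p) V) :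
    cohomologyClass (C.cocycle b) = 0 ↔ ∃ k : ZMod p, ∀ u v, b u v - b v u = k * B u v := by
  rw [cohomologyClass_eq_zero_iff]
  simp only [unitVal_cocycle]
  constructor
  · rintro ⟨c, hc⟩
    have hleft : ∀ k g, c (C.incl k) * c g = c (C.incl k * g) := fun k g => by
      rw [hc, vec_incl, map_zero, LinearMap.zero_apply, stdChar_zero, one_mul]
    obtain ⟨k, hk⟩ := exists_eq_stdChar_mul (MonoidHom.mk' (fun m => c (C.incl m)) fun m n => by
      rw [map_mul, hleft])
    refine ⟨-k, fun u v => ?_⟩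
    obtain ⟨g, rfl⟩ := C.exists_vec_eq u
    obtain ⟨h, rfl⟩ := C.exists_vec_eq v
    have h1 : ⁅g, h⁆ * (h * g) = g * h := by rw [commutatorElement_def]; group
    have h2 : c ⁅g, h⁆ * c (h * g) = c (g * h) := by
      rw [← h1, C.commutator_eq, hleft]
    have h3 : c ⁅g, h⁆ = stdChar p (k * B (C.vec g) (C.vec h)) := by
      rw [C.commutator_eq]
      exact hk _
    have h4 : stdChar p (b (C.vec h) (C.vec g)) =
        stdChar p (b (C.vec g) (C.vec h) + k * B (C.vec g) (C.vec h)) := by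
      rw [stdChar_add, ← h3]
      refine mul_right_cancel (b := c (h * g)) ?_
      rw [← hc, mul_assoc, h2, ← hc, mul_comm]
    have h5 := stdChar_injective h4
    rw [h5]
    ring
  · rintro ⟨k, hk⟩
    -- Only the values on the range of `C.incl` matter, where `Function.invFun` recovers the
    -- exponent.
    let r : G → ℂˣ := fun g => stdChar p (-k * (Function.invFun C.incl g).toAdd)
    have hr : ∀ m, r (C.incl m) = stdChar p (-k * m.toAdd) := fun m => by
      simp only [r]
      rw [Function.leftInverse_invFun C.incl_injective m]
    refine (C.cocycle b).isCocycle.exists_coboundary C.incl.range r ?_ (fun g h => ?_)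
      (fun g h => ?_)
    · rintro _ ⟨m, rfl⟩ _ ⟨n, rfl⟩
      rw [← map_mul, hr, hr, hr, unitVal_cocycle, vec_incl, map_zero, LinearMap.zero_apply,
        stdChar_zero, one_mul, ← stdChar_add, toAdd_mul, mul_add]
    · rw [C.commutator_eq]
      exact ⟨_, rfl⟩
    · simp only [unitVal_cocycle]
      rw [C.vec_commutator, map_zero, LinearMap.zero_apply, stdChar_zero, mul_one, C.commutator_eq,
        hr, ← stdChar_add]
      congr 1
      have := hk (C.vec g) (C.vec h)
      change b (C.vec g) (C.vec h) + -k * B (C.vec g) (C.vec h) = b (C.vec h) (C.vec g)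
      rw [neg_mul, ← this]
      ring

/-- Commutators of lifts to a central extension therefore do not depend on the lifts. -/
theorem commutatorElement_mul_mul_of_central {E : Type} [Group E] {z z' : E}
    (hz : ∀ x, Commute z x) (hz' : ∀ x, Commute z' x) (a b : E) :
    ⁅z * a, z' * b⁆ = ⁅a, b⁆ := by
  rw [commutatorElement_mul_left_eq_conj_mul, commutatorElement_mul_right_eq_mul_conj,
    commutatorElement_eq_one_iff_commute.2 (hz _), commutatorElement_eq_one_iff_commute.2 (hz' a).symm,
    mul_one, one_mul, (hz' _).eq, mul_inv_cancel_right, (hz _).eq, mul_inv_cancel_right]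

/-- If `dim V ≥ 3`, the preimage of the centre in a central extension by `ℂˣ` is central. -/
theorem commute_of_proj_eq_one [FiniteDimensional (ZMod p) V] (hB : B.IsAlt)
    (hn : ∀ u, (∀ v, B u v = 0) → u = 0) (hV : 3 ≤ Module.finrank (ZMod p) V)
    {f : G → G → ℂˣ} (hf : IsCocycle f) (x y : hf.Extension) (hx : C.proj (hf.proj x) = 1) :
    Commute x y := by
  -- Lifts of `a` and `b` orthogonal to `y` commute with `y` up to scalars, so their commutator `w`
  -- commutes with `y`. As B(a,b) ≠ 0, `w` lies over a generator of the central ℤ/p, and `x` is a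
  -- scalar times a power of `w`.
  obtain ⟨u, v, hu, hv, huv⟩ := exists_orthogonal_pair B hB hn hV (C.vec (hf.proj y))
  obtain ⟨a, rfl⟩ := C.exists_vec_eq u
  obtain ⟨b, rfl⟩ := C.exists_vec_eq v
  have hcent : ∀ g, B (C.vec g) (C.vec (hf.proj y)) = 0 →
      ∃ m, hf.incl m * hf.lift g = y * hf.lift g * y⁻¹ := by
    intro g hg
    have h0 : hf.proj ⁅y, hf.lift g⁆ = 1 := by
      rw [map_commutatorElement, C.commutator_eq, hf.proj_lift]
      change C.incl (Multiplicative.ofAdd (B (C.vec _) (C.vec g))) = 1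
      rw [← hB.neg_eq, hg, neg_zero, ofAdd_zero, map_one]
    obtain ⟨m, hm⟩ := hf.exists_incl_eq h0
    refine ⟨m, ?_⟩
    rw [hm, commutatorElement_def]
    group
  obtain ⟨m, hm⟩ := hcent a hu
  obtain ⟨m', hm'⟩ := hcent b hv
  set w := ⁅hf.lift a, hf.lift b⁆ with hw
  have hwy : Commute w y := by
    have h1 : y * w * y⁻¹ = w := by
      rw [hw, conjugate_commutatorElement, ← hm, ← hm', commutatorElement_mul_mul_of_central
        (hf.incl_commute m) (hf.incl_commute m')]
    exact (mul_inv_eq_iff_eq_mul.1 h1).symm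
  obtain ⟨k, hk⟩ := C.exists_incl_eq hx
  -- `w` lies over B(a,b) and `x` over `k`, which forces the exponent k / B(a,b).
  have h2 : hf.proj (x * (w ^ (k.toAdd / B (C.vec a) (C.vec b)).val)⁻¹) = 1 := by
    rw [map_mul, map_inv, map_pow, hw, map_commutatorElement, hf.proj_lift, hf.proj_lift,
      C.commutator_eq, ← hk, ← map_pow, mul_inv_eq_one]
    congr 1
    rw [← ofAdd_nsmul, nsmul_eq_mul, ZMod.natCast_zmod_val]
    change k = Multiplicative.ofAdd (k.toAdd / B (C.vec a) (C.vec b) * B (C.vec a) (C.vec b))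
    rw [div_mul_cancel₀ _ huv]
    rfl
  obtain ⟨n, hn'⟩ := hf.exists_incl_eq h2
  rw [eq_mul_inv_iff_mul_eq] at hn'
  rw [← hn']
  exact (hf.incl_commute n y).mul_left (hwy.pow_left _)

/-- If `dim V ≥ 3`, every class is represented by the cocycle of a bilinear form. -/
theorem exists_class_cocycle_eq [FiniteDimensional (ZMod p) V] (hB : B.IsAlt)
    (hn : ∀ u, (∀ v, B u v = 0) → u = 0) (hV : 3 ≤ Module.finrank (ZMod p) V)
    (α : TwoCocycle ℂ G) : ∃ b, cohomologyClass (C.cocycle b) = cohomologyClass α := by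
  let f := α.unitVal
  let hf : IsCocycle f := α.isCocycle
  let q : hf.Extension →* Multiplicative V := C.proj.comp hf.proj
  have hqs : Function.Surjective q := fun v => by
    obtain ⟨g, hg⟩ := C.proj_surjective v
    exact ⟨hf.lift g, hg⟩
  have hq : ∀ x y, q x = 1 → Commute x y := fun x y hx =>
    C.commute_of_proj_eq_one hB hn hV hf x y hx
  have hqc : ∀ x y, q ⁅x, y⁆ = 1 := fun x y => by
    rw [map_commutatorElement, commutatorElement_eq_one_iff_commute]
    exact Commute.all _ _
  have hcl : ∀ x y z : hf.Extension, Commute ⁅x, y⁆ z := fun x y z => hq _ _ (hqc x y)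
  let j : ℂˣ →* q.ker := hf.incl.codRestrict q.ker fun m => by
    rw [MonoidHom.mem_ker]
    exact map_one C.proj
  -- The kernel of `q` is abelian, so ℂˣ splits off it; ρ turns commutators in the extension into a
  -- scalar pairing on `V`.
  obtain ⟨ρ, hρ⟩ := exists_retraction (fun x y : q.ker => Subtype.ext (hq x.1 y.1 x.2)) j
    (fun m n h => hf.incl_injective (congrArg Subtype.val h))
  obtain ⟨a, ha⟩ := exists_bilinForm_of_bimultiplicative (p := p) q hqs
    (fun x y => ρ ⟨⁅x, y⁆, hqc x y⟩)
    (fun x x' y => by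
      rw [← map_mul]
      exact congrArg ρ (Subtype.ext (commutatorElement_mul_left_of_central hcl x x' y)))
    (fun x y y' => by
      rw [← map_mul]
      exact congrArg ρ (Subtype.ext (commutatorElement_mul_right_of_central hcl x y y')))
    (fun x y hx => by
      rw [← map_one ρ]
      exact congrArg ρ (Subtype.ext (commutatorElement_eq_one_iff_commute.2 (hq x y hx))))
    (fun x y hy => by
      rw [← map_one ρ]
      exact congrArg ρ (Subtype.ext (commutatorElement_eq_one_iff_commute.2 (hq y x hy).symm)))
  have haalt : a.IsAlt := fun u => by
    obtain ⟨x, rfl⟩ := hqs (Multiplicative.ofAdd u)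
    refine stdChar_injective ?_
    rw [stdChar_zero]
    refine (ha x x).symm.trans ?_
    rw [← map_one ρ]
    exact congrArg ρ (Subtype.ext (commutatorElement_self x))
  -- The cocycle of `b` has commutator pairing `a`. Subtracting it cancels the pairing, and then ρ
  -- on the lifts of central elements meets the hypotheses of `exists_coboundary`.
  obtain ⟨b, hb⟩ := exists_sub_flip_eq a haalt
  refine ⟨b, ?_⟩
  rw [eq_comm, ← sub_eq_zero, ← cohomologyClassHom_apply, ← cohomologyClassHom_apply, ← map_sub,
    cohomologyClassHom_apply, cohomologyClass_eq_zero_iff]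
  classical
  let r : G → ℂˣ := fun g => if h : C.proj g = 1 then ρ ⟨hf.lift g, h⟩ else 1
  have hr : ∀ g (h : C.proj g = 1), r g = ρ ⟨hf.lift g, h⟩ := fun g h => dif_pos h
  refine (α - C.cocycle b).isCocycle.exists_coboundary C.proj.ker r ?_ (fun g h => ?_)
    (fun g h => ?_)
  · intro x hx y hy
    rw [MonoidHom.mem_ker] at hx hy
    have hxy : C.proj (x * y) = 1 := by rw [map_mul, hx, hy, one_mul]
    rw [hr x hx, hr y hy, hr _ hxy, TwoCocycle.unitVal_sub, unitVal_cocycle,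
      C.vec_eq_zero_iff.2 hx, map_zero, LinearMap.zero_apply, stdChar_zero, div_one, ← hρ (α.unitVal x y),
      ← map_mul, ← map_mul]
    exact congrArg ρ (Subtype.ext (hf.lift_mul_lift x y))
  · exact C.vec_commutator g h
  · have hw : C.proj ⁅g, h⁆ = 1 := C.vec_commutator g h
    have h1 : ⁅g, h⁆ * (h * g) = g * h := by rw [commutatorElement_def]; group
    have h2 : hf.incl (f g h) * hf.lift ⁅g, h⁆ =
        ⁅hf.lift g, hf.lift h⁆ * hf.incl (f h g) * hf.incl (f ⁅g, h⁆ (h * g)) := by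
      refine mul_right_cancel (b := hf.lift (h * g)) ?_
      have h3 : ⁅hf.lift g, hf.lift h⁆ * (hf.lift h * hf.lift g) = hf.lift g * hf.lift h := by
        rw [commutatorElement_def]; group
      rw [hf.lift_mul_lift, hf.lift_mul_lift] at h3
      rw [mul_assoc, hf.lift_mul_lift, h1, ← mul_assoc, (hf.incl_commute _ _).eq, mul_assoc, ← h3,
        ← mul_assoc, ← mul_assoc, mul_assoc ⁅hf.lift g, hf.lift h⁆, mul_assoc ⁅hf.lift g, hf.lift h⁆,
          (hf.incl_commute (f h g) _).eq, (hf.incl_commute _ ⁅hf.lift g, hf.lift h⁆).eq]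
      simp only [mul_assoc]
    have h4 : f g h * r ⁅g, h⁆ =
        ρ ⟨⁅hf.lift g, hf.lift h⁆, hqc _ _⟩ * f h g * f ⁅g, h⁆ (h * g) := by
      rw [hr _ hw, ← hρ (f g h), ← hρ (f h g), ← hρ (f ⁅g, h⁆ (h * g)), ← map_mul, ← map_mul,
        ← map_mul]
      exact congrArg ρ (Subtype.ext h2)
    have h5 : ρ ⟨⁅hf.lift g, hf.lift h⁆, hqc _ _⟩ = stdChar p (b (C.vec g) (C.vec h)) /
        stdChar p (b (C.vec h) (C.vec g)) := by
      rw [← stdChar_sub, hb]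
      exact ha _ _
    rw [h5] at h4
    simp only [TwoCocycle.unitVal_sub, unitVal_cocycle]
    rw [C.vec_commutator, map_zero, LinearMap.zero_apply, stdChar_zero, div_one]
    change f g h / _ * r ⁅g, h⁆ = f h g / _ * f ⁅g, h⁆ (h * g)
    rw [div_mul_eq_mul_div, h4]
    refine Units.ext ?_
    push_cast
    field_simp

end SymplecticCover

/-! ### Comparing twisted group algebras over the same symplectic space. -/

theorem sum_stdChar_mul {p : ℕ} [Fact p.Prime] (k : ZMod p) :
    ∑ m : ZMod p, (stdChar p (k * m) : ℂ) = if k = 0 then (p : ℂ) else 0 := by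
  split_ifs with hk
  · simp [hk, ZMod.card]
  · have h1 : (stdChar p k : ℂ) * ∑ m : ZMod p, (stdChar p (k * m) : ℂ) =
        ∑ m : ZMod p, (stdChar p (k * m) : ℂ) := by
      rw [Finset.mul_sum]
      refine Fintype.sum_equiv (Equiv.addRight 1) _ _ fun m => ?_
      rw [Equiv.coe_addRight, mul_add, mul_one, stdChar_add, Units.val_mul, mul_comm]
    have h2 : (stdChar p k : ℂ) ≠ 1 := fun h => hk (stdChar_injective (by
      rw [stdChar_zero]
      exact Units.ext h))
    have h3 : ((stdChar p k : ℂ) - 1) * ∑ m : ZMod p, (stdChar p (k * m) : ℂ) = 0 := by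
      rw [sub_mul, h1, one_mul, sub_self]
    exact (mul_eq_zero.1 h3).resolve_left (sub_ne_zero.2 h2)

namespace SymplecticCover

open TwistedGroupRing

variable {p : ℕ} [Fact p.Prime] {V : Type} [AddCommGroup V] [Module (ZMod p) V]
  {B : LinearMap.BilinForm (ZMod p) V} {G H : Type} [Group G] [Group H]
  (C : SymplecticCover p B G) (D : SymplecticCover p B H)

/-- The inclusion of `ℤ/p`, written additively in the argument. -/
def cent (m : ZMod p) : G := C.incl (Multiplicative.ofAdd m)

theorem cent_add (m n : ZMod p) : C.cent (m + n) = C.cent m * C.cent n := map_mul C.incl _ _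

@[simp] theorem cent_zero : C.cent 0 = 1 := map_one C.incl

@[simp] theorem vec_cent (m : ZMod p) : C.vec (C.cent m) = 0 := C.vec_incl _

/-- The fibre product of two covers over `V`. -/
def fiberProd : Subgroup (G × H) :=
  (C.proj.comp (MonoidHom.fst G H)).eqLocus (D.proj.comp (MonoidHom.snd G H))

theorem mem_fiberProd {x : G × H} : x ∈ C.fiberProd D ↔ C.vec x.1 = D.vec x.2 := Iff.rfl

/-- The central elements of the fibre product. -/
def centPair (m n : ZMod p) : C.fiberProd D :=
  ⟨(C.cent m, D.cent n), by rw [mem_fiberProd, vec_cent, vec_cent]⟩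

/-- Both covers have commutator form `B`, so commutators in the fibre product are diagonal central
pairs; ζ^(k(m-n)) is trivial on these and extends. -/
theorem exists_fiberProd_char (k : ZMod p) : ∃ c : C.fiberProd D →* ℂˣ,
    ∀ m n, c (C.centPair D m n) = stdChar p (k * (m - n)) := by
  let j : Multiplicative (ZMod p × ZMod p) →* C.fiberProd D := MonoidHom.mk'
    (fun x => C.centPair D x.toAdd.1 x.toAdd.2) fun x y => Subtype.ext
      (Prod.ext (C.cent_add _ _) (D.cent_add _ _))
  have hj : Function.Injective j := fun x y h => by
    have h1 := congrArg (fun z : C.fiberProd D => z.1.1) h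
    have h2 := congrArg (fun z : C.fiberProd D => z.1.2) h
    exact Prod.ext (C.incl_injective h1) (D.incl_injective h2)
  let ψ : Multiplicative (ZMod p × ZMod p) →* ℂˣ := MonoidHom.mk'
    (fun x => stdChar p (k * (x.toAdd.1 - x.toAdd.2))) fun x y => by
      rw [← stdChar_add]
      congr 1
      simp only [toAdd_mul, Prod.fst_add, Prod.snd_add]
      ring
  have hψ : ∀ x, ψ ((MonoidHom.ofInjective hj).symm ⟨j x, x, rfl⟩) = ψ x := fun x =>
    congrArg ψ ((MonoidHom.ofInjective hj).symm_apply_apply x)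
  have hcomm : ∀ x ∈ commutator (C.fiberProd D), ∃ m, x = C.centPair D m m := by
    let T : Subgroup (C.fiberProd D) :=
      { carrier := {x | ∃ m, x = C.centPair D m m}
        one_mem' := ⟨0, Subtype.ext (Prod.ext C.cent_zero.symm D.cent_zero.symm)⟩
        mul_mem' := by
          rintro _ _ ⟨m, rfl⟩ ⟨n, rfl⟩
          exact ⟨m + n, Subtype.ext (Prod.ext (C.cent_add m n).symm (D.cent_add m n).symm)⟩
        inv_mem' := by
          rintro _ ⟨m, rfl⟩
          exact ⟨-m, Subtype.ext (Prod.ext (map_inv C.incl (Multiplicative.ofAdd m)).symm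
            (map_inv D.incl (Multiplicative.ofAdd m)).symm)⟩ }
    have : commutator (C.fiberProd D) ≤ T := by
      rw [commutator_eq_closure, Subgroup.closure_le]
      rintro _ ⟨x, y, rfl⟩
      refine ⟨B (C.vec x.1.1) (C.vec y.1.1), Subtype.ext (Prod.ext (C.commutator_eq _ _) ?_)⟩
      refine (D.commutator_eq x.1.2 y.1.2).trans ?_
      have h1 := (mem_fiberProd C D).1 x.2
      have h2 := (mem_fiberProd C D).1 y.2
      rw [h1, h2]
      rfl
    exact fun x hx => this hx
  obtain ⟨c, hc⟩ := exists_monoidHom_extension j.range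
    (ψ.comp (MonoidHom.ofInjective hj).symm.toMonoidHom) (by
      rintro ⟨_, x, rfl⟩ hx
      refine (hψ x).trans ?_
      obtain ⟨m, hm⟩ := hcomm _ hx
      have : x = Multiplicative.ofAdd (m, m) := hj hm
      rw [this]
      change stdChar p (k * (m - m)) = 1
      rw [sub_self, mul_zero, stdChar_zero])
  exact ⟨c, fun m n => (hc ⟨j (Multiplicative.ofAdd (m, n)), _, rfl⟩).trans (hψ _)⟩

variable (b : LinearMap.BilinForm (ZMod p) V)

theorem of_cent_mul_of (m : ZMod p) (h : H) :
    of (D.cocycle b) (D.cent m) * of (D.cocycle b) h = of (D.cocycle b) (D.cent m * h) := by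
  rw [of_mul_of, unitVal_cocycle, vec_cent, map_zero, LinearMap.zero_apply, stdChar_zero,
    Units.val_one, one_smul]

theorem of_mul_of_cent (m : ZMod p) (h : H) :
    of (D.cocycle b) h * of (D.cocycle b) (D.cent m) = of (D.cocycle b) (D.cent m * h) := by
  rw [of_mul_of, unitVal_cocycle, vec_cent, map_zero, stdChar_zero, Units.val_one, one_smul,
    cent, (D.incl_commute _ h).eq]

theorem of_cocycle_one : of (D.cocycle b) 1 = 1 := by
  rw [of_one, unitVal_cocycle, ← D.cent_zero, vec_cent, map_zero, stdChar_zero, Units.val_one,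
    one_smul]

/-- The central idempotent attached to the `k`-th character of the centre. -/
noncomputable def idem (k : ZMod p) : TwistedGroupRing (D.cocycle b) :=
  (p : ℂ)⁻¹ • ∑ m : ZMod p, (stdChar p (-(k * m)) : ℂ) • of (D.cocycle b) (D.cent m)

theorem of_mul_idem (k : ZMod p) (h : H) :
    of (D.cocycle b) h * D.idem b k = D.idem b k * of (D.cocycle b) h := by
  rw [idem, mul_smul_comm, smul_mul_assoc, Finset.mul_sum, Finset.sum_mul]
  refine congrArg _ (Finset.sum_congr rfl fun m _ => ?_)
  rw [mul_smul_comm, smul_mul_assoc, of_mul_of_cent, of_cent_mul_of]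

theorem idem_mul_cent (k n : ZMod p) :
    D.idem b k * of (D.cocycle b) (D.cent n) = (stdChar p (k * n) : ℂ) • D.idem b k := by
  rw [idem, smul_mul_assoc, smul_comm (stdChar p (k * n) : ℂ)]
  refine congrArg _ ?_
  rw [Finset.sum_mul, Finset.smul_sum]
  refine Fintype.sum_equiv (Equiv.addRight n) _ _ fun m => ?_
  rw [smul_mul_assoc, of_cent_mul_of, ← cent_add, smul_smul, ← Units.val_mul, ← stdChar_add,
    Equiv.coe_addRight]
  congr 3
  ring

theorem idem_mul_of_cent_mul (k n : ZMod p) (h : H) :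
    D.idem b k * of (D.cocycle b) (D.cent n * h) =
      (stdChar p (k * n) : ℂ) • (D.idem b k * of (D.cocycle b) h) := by
  rw [← of_cent_mul_of, ← mul_assoc, idem_mul_cent, smul_mul_assoc]

theorem idem_mul_idem (k l : ZMod p) :
    D.idem b k * D.idem b l = if k = l then D.idem b k else 0 := by
  have hp : (p : ℂ) ≠ 0 := Nat.cast_ne_zero.2 (Fact.out : p.Prime).ne_zero
  have h1 : D.idem b k * D.idem b l =
      (p : ℂ)⁻¹ • (∑ m : ZMod p, (stdChar p ((k - l) * m) : ℂ)) • D.idem b k := by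
    rw [idem.eq_def D b l, mul_smul_comm, Finset.mul_sum, Finset.sum_smul]
    congr 1
    refine Finset.sum_congr rfl fun m _ => ?_
    rw [mul_smul_comm, idem_mul_cent, smul_smul, ← Units.val_mul, ← stdChar_add]
    congr 3
    ring
  rw [h1, sum_stdChar_mul]
  simp only [sub_eq_zero]
  split_ifs
  · rw [smul_smul, inv_mul_cancel₀ hp, one_smul]
  · rw [zero_smul, smul_zero]

theorem sum_idem : ∑ k, D.idem b k = 1 := by
  have hp : (p : ℂ) ≠ 0 := Nat.cast_ne_zero.2 (Fact.out : p.Prime).ne_zero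
  simp only [idem]
  rw [← Finset.smul_sum, Finset.sum_comm]
  have h1 : ∀ m : ZMod p, ∑ k : ZMod p, (stdChar p (-(k * m)) : ℂ) • of (D.cocycle b) (D.cent m) =
      if m = 0 then (p : ℂ) • 1 else 0 := fun m => by
    rw [← Finset.sum_smul]
    have h2 : ∀ k : ZMod p, -(k * m) = (-m) * k := fun k => by ring
    simp only [h2]
    rw [sum_stdChar_mul]
    simp only [neg_eq_zero]
    split_ifs with hm
    · rw [hm, cent_zero, of_cocycle_one]
    · rw [zero_smul]
  simp only [h1]
  rw [Finset.sum_ite_eq' Finset.univ (0 : ZMod p), if_pos (Finset.mem_univ _), smul_smul,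
    inv_mul_cancel₀ hp, one_smul]

/-- For (g,h) in the fibre product, `W` weights h̄ on the k-th block by the character `c k`. Moving
h by a central n multiplies h̄ there by ζ^(kn) and `c k` by ζ^(-kn), so `W` depends on g alone. Both
cocycles depend only on images in `V`, so these elements multiply like the ḡ. -/
theorem nonempty_algEquiv_cocycle [Finite G] [Finite H] :
    Nonempty (TwistedGroupRing (C.cocycle b) ≃ₐ[ℂ] TwistedGroupRing (D.cocycle b)) := by
  have hp : (p : ℂ) ≠ 0 := Nat.cast_ne_zero.2 (Fact.out : p.Prime).ne_zero
  choose c hc using C.exists_fiberProd_char D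
  let W : C.fiberProd D → TwistedGroupRing (D.cocycle b) := fun x =>
    ∑ k, (c k x : ℂ) • (D.idem b k * of (D.cocycle b) x.1.2)
  have hWmul : ∀ x y : C.fiberProd D, W x * W y =
      ((C.cocycle b).unitVal x.1.1 y.1.1 : ℂ) • W (x * y) := by
    intro x y
    simp only [W]
    rw [Finset.sum_mul, Finset.smul_sum]
    refine Finset.sum_congr rfl fun k _ => ?_
    have h1 : ∀ l, (c k x : ℂ) • (D.idem b k * of (D.cocycle b) x.1.2) *
        ((c l y : ℂ) • (D.idem b l * of (D.cocycle b) y.1.2)) = if k = l then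
        ((C.cocycle b).unitVal x.1.1 y.1.1 : ℂ) •
          (c k (x * y) : ℂ) • (D.idem b k * of (D.cocycle b) (x * y).1.2) else 0 := by
      intro l
      have h2 : D.idem b k * of (D.cocycle b) x.1.2 * (D.idem b l * of (D.cocycle b) y.1.2) =
          D.idem b k * D.idem b l * (of (D.cocycle b) x.1.2 * of (D.cocycle b) y.1.2) := by
        rw [mul_assoc, ← mul_assoc (of _ _) (D.idem b l), of_mul_idem]
        simp only [mul_assoc]
      rw [smul_mul_smul_comm, h2, idem_mul_idem, of_mul_of]
      split_ifs with hkl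
      · subst hkl
        have h3 := (mem_fiberProd C D).1 x.2
        have h4 := (mem_fiberProd C D).1 y.2
        rw [map_mul, unitVal_cocycle, unitVal_cocycle, h3, h4, mul_smul_comm, smul_smul,
          smul_smul, Units.val_mul, mul_comm]
        rfl
      · rw [zero_mul, smul_zero]
    rw [Finset.mul_sum]
    simp only [h1]
    rw [Finset.sum_ite_eq Finset.univ k, if_pos (Finset.mem_univ _)]
  have hWcent : ∀ (m n : ZMod p) (x : C.fiberProd D), W (C.centPair D m n * x) =
      ∑ k, (stdChar p (k * m) : ℂ) • (c k x : ℂ) • (D.idem b k * of (D.cocycle b) x.1.2) := by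
    intro m n x
    refine Finset.sum_congr rfl fun k _ => ?_
    change (c k (C.centPair D m n * x) : ℂ) •
      (D.idem b k * of (D.cocycle b) (D.cent n * x.1.2)) = _
    rw [map_mul, hc, idem_mul_of_cent_mul, smul_smul, smul_smul, ← Units.val_mul, ← Units.val_mul,
      mul_right_comm, ← stdChar_add]
    congr 4
    ring
  have hWfst : ∀ x y : C.fiberProd D, x.1.1 = y.1.1 → W x = W y := by
    intro x y hxy
    have h1 : D.proj (x.1.2 * y.1.2⁻¹) = 1 := by
      rw [map_mul, map_inv, mul_inv_eq_one]
      have h3 := (mem_fiberProd C D).1 x.2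
      have h4 := (mem_fiberProd C D).1 y.2
      rw [hxy] at h3
      exact h3.symm.trans h4
    obtain ⟨n, hn⟩ := D.exists_incl_eq h1
    have h2 : x = C.centPair D 0 n.toAdd * y := by
      refine Subtype.ext (Prod.ext ?_ ?_)
      · change x.1.1 = C.cent 0 * y.1.1
        rw [cent_zero, one_mul, hxy]
      · change x.1.2 = D.incl n * y.1.2
        rw [hn, inv_mul_cancel_right]
    rw [h2, hWcent]
    refine Finset.sum_congr rfl fun k _ => ?_
    rw [mul_zero, stdChar_zero, Units.val_one, one_smul]
  choose s hs using fun g => D.exists_vec_eq (C.vec g)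
  let U : G → TwistedGroupRing (D.cocycle b) := fun g => W ⟨(g, s g), (hs g).symm⟩
  have hU : ∀ x : C.fiberProd D, W x = U x.1.1 := fun x => hWfst _ _ rfl
  have : NeZero p := ⟨(Fact.out : p.Prime).ne_zero⟩
  refine nonempty_algEquiv (by rw [C.natCard_eq, D.natCard_eq]) _ _ U (fun g h => ?_) fun h => ?_
  · exact (hWmul _ _).trans (congrArg _ (hU _))
  · obtain ⟨g, hg⟩ := C.exists_vec_eq (D.vec h)
    let x : C.fiberProd D := ⟨(g, h), hg⟩
    -- Fourier inversion over the central ℤ/p of `G` isolates the l-th block of `W x`.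
    have hmem : ∀ l, D.idem b l * of (D.cocycle b) h ∈ Submodule.span ℂ (Set.range U) := by
      intro l
      have h1 : ∑ m : ZMod p, (stdChar p (-(l * m)) : ℂ) • W (C.centPair D m 0 * x) =
          (p : ℂ) • (c l x : ℂ) • (D.idem b l * of (D.cocycle b) h) := by
        simp only [hWcent, Finset.smul_sum]
        rw [Finset.sum_comm]
        have h2 : ∀ k : ZMod p, ∑ m : ZMod p, (stdChar p (-(l * m)) : ℂ) •
            (stdChar p (k * m) : ℂ) • (c k x : ℂ) • (D.idem b k * of (D.cocycle b) x.1.2) =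
            if k = l then (p : ℂ) • (c k x : ℂ) • (D.idem b k * of (D.cocycle b) x.1.2)
              else 0 := by
          intro k
          have h3 : ∀ m : ZMod p, (stdChar p (-(l * m)) : ℂ) * (stdChar p (k * m) : ℂ) =
              (stdChar p ((k - l) * m) : ℂ) := fun m => by
            rw [← Units.val_mul, ← stdChar_add]
            congr 2
            ring
          simp only [smul_smul _ (stdChar p _ : ℂ), h3]
          rw [← Finset.sum_smul, sum_stdChar_mul]
          simp only [sub_eq_zero]
          split_ifs
          · rfl
          · rw [zero_smul]
        simp only [h2]
        rw [Finset.sum_ite_eq' Finset.univ l, if_pos (Finset.mem_univ _)]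
      have h4 : D.idem b l * of (D.cocycle b) h = (((c l x)⁻¹ : ℂˣ) : ℂ) • (p : ℂ)⁻¹ •
          ∑ m : ZMod p, (stdChar p (-(l * m)) : ℂ) • W (C.centPair D m 0 * x) := by
        rw [h1, smul_smul (p : ℂ)⁻¹, inv_mul_cancel₀ hp, one_smul, smul_smul, Units.inv_mul,
          one_smul]
      rw [h4]
      refine Submodule.smul_mem _ _ (Submodule.smul_mem _ _ (Submodule.sum_mem _ fun m _ =>
        Submodule.smul_mem _ _ ?_))
      rw [hU]
      exact Submodule.subset_span ⟨_, rfl⟩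
    rw [← one_mul (of (D.cocycle b) h), ← sum_idem, Finset.sum_mul]
    exact Submodule.sum_mem _ fun l _ => hmem l

end SymplecticCover

/-! ### The case n > 1. -/

theorem SymplecticCover.finrank_eq {p n : ℕ} [Fact p.Prime] {V : Type} [AddCommGroup V]
    [Module (ZMod p) V] {B : LinearMap.BilinForm (ZMod p) V} {G : Type} [Group G]
    (C : SymplecticCover p B G) (hG : Nat.card G = p ^ (n + 1)) :
    FiniteDimensional (ZMod p) V ∧ Module.finrank (ZMod p) V = n := by
  have hp := (Fact.out : p.Prime)
  have : NeZero p := ⟨hp.ne_zero⟩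
  have h1 : Nat.card V = p ^ n := by
    have := C.natCard_eq
    rw [hG, pow_succ'] at this
    exact (Nat.eq_of_mul_eq_mul_left hp.pos this).symm
  have : Finite V := Nat.finite_of_card_ne_zero (by rw [h1]; exact pow_ne_zero _ hp.ne_zero)
  refine ⟨inferInstance, ?_⟩
  have h2 := Module.natCard_eq_pow_finrank (K := ZMod p) (V := V)
  rw [h1, Nat.card_zmod] at h2
  exact (Nat.pow_right_injective hp.two_le h2).symm

/-- Two symplectic covers of the same space of dimension at least three are related. -/
theorem SymplecticCover.twistedGroupRingRel {p : ℕ} [Fact p.Prime] {V : Type} [AddCommGroup V]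
    [Module (ZMod p) V] {B : LinearMap.BilinForm (ZMod p) V} {G H : Type} [Group G] [Group H]
    [Finite G] [Finite H] [FiniteDimensional (ZMod p) V] (hB : B.IsAlt)
    (hn : ∀ u, (∀ v, B u v = 0) → u = 0) (hV : 3 ≤ Module.finrank (ZMod p) V)
    (C : SymplecticCover p B G) (D : SymplecticCover p B H) :
    TwistedGroupRingRel ℂ G H := by
  have h1 : ∀ α, ∃ b, cohomologyClass (C.cocycle b) = cohomologyClass α :=
    fun α => C.exists_class_cocycle_eq hB hn hV α
  have h2 : ∀ α, ∃ b, cohomologyClass (D.cocycle b) = cohomologyClass α :=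
    fun α => D.exists_class_cocycle_eq hB hn hV α
  have h3 : ∀ b, cohomologyClass (C.cocycle b) = 0 ↔ cohomologyClass (D.cocycle b) = 0 :=
    fun b => by rw [C.class_cocycle_eq_zero_iff, D.class_cocycle_eq_zero_iff]
  have h4 : ∀ b, Nonempty (TwistedGroupRing (C.cocycle b) ≃ₐ[ℂ] TwistedGroupRing (D.cocycle b)) :=
    fun b => C.nonempty_algEquiv_cocycle D b
  have h5 := twistedGroupRingRel_of_parametrization (X := LinearMap.BilinForm (ZMod p) V)
    (G := G) (H := H) C.cocycle D.cocycle
  exact h5 h1 h2 h3 h4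

/-- Extra-special groups of the same order `p ^ (2 * n + 1)`, `n ≥ 2`, are related. -/
theorem IsExtraSpecial.twistedGroupRingRel {p n : ℕ} (hp : p.Prime) {G H : Type} [Group G]
    [Group H] (hG : IsExtraSpecial p G) (hH : IsExtraSpecial p H)
    (hGcard : Nat.card G = p ^ (2 * n + 1)) (hHcard : Nat.card H = p ^ (2 * n + 1)) (hn : 1 < n) :
    TwistedGroupRingRel ℂ G H := by
  have : Fact p.Prime := ⟨hp⟩
  have : Finite G := Nat.finite_of_card_ne_zero (by rw [hGcard]; exact pow_ne_zero _ hp.ne_zero)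
  have : Finite H := Nat.finite_of_card_ne_zero (by rw [hHcard]; exact pow_ne_zero _ hp.ne_zero)
  obtain ⟨V, _, _, B, hB, hBn, ⟨C⟩⟩ := hG.exists_symplecticCover
  obtain ⟨V', _, _, B', hB', hBn', ⟨D⟩⟩ := hH.exists_symplecticCover
  obtain ⟨_, hV⟩ := C.finrank_eq hGcard
  obtain ⟨_, hV'⟩ := D.finrank_eq hHcard
  obtain ⟨e, he⟩ := exists_isometry_of_finrank_eq (2 * n) B B' hB hB' hBn hBn' hV hV'
  -- The bound 3 ≤ 2n is where n > 1 is needed.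
  exact SymplecticCover.twistedGroupRingRel hB' hBn' (by omega) (C.ofIsometry e he) D

/-! ### Two-generator presentations of groups of order p³. -/

/-- The elements `x, y` satisfy the relations `x ^ p = c ^ s`, `y ^ p = c ^ t`, `c ^ p = 1`, where
`c = ⁅x, y⁆` commutes with `x` and `y`. -/
structure PairRel (p s t : ℕ) {Q : Type} [Group Q] (x y : Q) : Prop where
  commute_left : Commute ⁅x, y⁆ x
  commute_right : Commute ⁅x, y⁆ y
  commutator_pow : ⁅x, y⁆ ^ p = 1
  left_pow : x ^ p = ⁅x, y⁆ ^ s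
  right_pow : y ^ p = ⁅x, y⁆ ^ t

namespace PairRel

variable {p s t : ℕ} {Q : Type} [Group Q] {x y : Q}

theorem conj_left (x y : Q) : y * x * y⁻¹ = ⁅x, y⁆⁻¹ * x := by
  rw [commutatorElement_def]; group

theorem mul_zpow_left (h : PairRel p s t x y) (i : ℤ) :
    y * x ^ i = x ^ i * y * ⁅x, y⁆ ^ (-i) := by
  have h1 : y * x ^ i * y⁻¹ = ⁅x, y⁆ ^ (-i) * x ^ i := by
    rw [← conj_zpow, conj_left, h.commute_left.inv_left.mul_zpow, inv_zpow, zpow_neg]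
  rw [mul_inv_eq_iff_eq_mul] at h1
  rw [h1, mul_assoc, ((h.commute_left.zpow_zpow _ _).mul_right (h.commute_right.zpow_left _)).eq]

theorem inv_mul_zpow_left (h : PairRel p s t x y) (i : ℤ) :
    y⁻¹ * x ^ i = x ^ i * y⁻¹ * ⁅x, y⁆ ^ i := by
  rw [inv_mul_eq_iff_eq_mul, ← mul_assoc, ← mul_assoc, h.mul_zpow_left,
    mul_assoc (x ^ i * y), (h.commute_right.inv_right.zpow_left (-i)).eq, ← mul_assoc,
    mul_inv_cancel_right, mul_assoc, ← zpow_add, neg_add_cancel, zpow_zero, mul_one]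

/-- Moving y past x^i costs only a power of the commutator, which commutes with both, so these words
are stable under left multiplication by generators and their inverses. -/
theorem exists_zpow_eq (h : PairRel p s t x y) {q : Q} (hq : q ∈ Subgroup.closure {x, y}) :
    ∃ i j k : ℤ, q = x ^ i * y ^ j * ⁅x, y⁆ ^ k := by
  induction hq using Subgroup.closure_induction_left with
  | one => exact ⟨0, 0, 0, by simp⟩
  | mul_left g hg q _ hq =>
    obtain ⟨i, j, k, rfl⟩ := hq
    rcases hg with rfl | rfl
    · refine ⟨1 + i, j, k, ?_⟩
      rw [zpow_add, zpow_one]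
      simp only [mul_assoc]
    · refine ⟨i, 1 + j, -i + k, ?_⟩
      rw [← mul_assoc, ← mul_assoc, h.mul_zpow_left, mul_assoc (x ^ i * g),
        (h.commute_right.zpow_zpow (-i) j).eq, zpow_add, zpow_add, zpow_one]
      simp only [mul_assoc]
  | inv_mul_cancel g hg q _ hq =>
    obtain ⟨i, j, k, rfl⟩ := hq
    rcases hg with rfl | rfl
    · refine ⟨-1 + i, j, k, ?_⟩
      rw [zpow_add, zpow_neg_one]
      simp only [mul_assoc]
    · refine ⟨i, -1 + j, i + k, ?_⟩
      rw [← mul_assoc, ← mul_assoc, h.inv_mul_zpow_left, mul_assoc (x ^ i * g⁻¹),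
        (h.commute_right.zpow_zpow i j).eq, zpow_add, zpow_add, zpow_neg_one]
      simp only [mul_assoc]

theorem exists_pow_eq (h : PairRel p s t x y) (hp : 0 < p) {q : Q}
    (hq : q ∈ Subgroup.closure {x, y}) :
    ∃ i j k : Fin p, q = x ^ (i : ℕ) * y ^ (j : ℕ) * ⁅x, y⁆ ^ (k : ℕ) := by
  -- Reducing an exponent of `x` or `y` modulo p leaves a power of the commutator, whose own
  -- exponent is reduced last.
  have hred : ∀ {z : Q} {n : ℕ}, z ^ p = ⁅x, y⁆ ^ n → ∀ i : ℤ,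
      ∃ (i' : Fin p) (l : ℤ), z ^ i = z ^ (i' : ℕ) * ⁅x, y⁆ ^ l := by
    intro z n hz i
    have h0 : 0 ≤ i % p := Int.emod_nonneg _ (by omega)
    have h1 : i % p < p := Int.emod_lt_of_pos _ (by omega)
    refine ⟨⟨(i % p).toNat, by omega⟩, n * (i / p), ?_⟩
    have h2 : ((i % p).toNat : ℤ) = i % p := Int.toNat_of_nonneg h0
    rw [← zpow_natCast z]
    simp only [h2]
    rw [zpow_mul, zpow_natCast, ← hz, ← zpow_natCast z p, ← zpow_mul, ← zpow_add, Int.emod_add_mul_ediv]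
  obtain ⟨i, j, k, rfl⟩ := h.exists_zpow_eq hq
  obtain ⟨i', l, hi⟩ := hred h.left_pow i
  obtain ⟨j', l', hj⟩ := hred h.right_pow j
  obtain ⟨k', l'', hk⟩ := hred (n := 0) (by rw [h.commutator_pow, pow_zero]) (l + l' + k)
  have hl'' : ⁅x, y⁆ ^ (l + l' + k) = ⁅x, y⁆ ^ (((l + l' + k) % p).toNat) := by
    have h0 : 0 ≤ (l + l' + k) % p := Int.emod_nonneg _ (by omega)
    rw [← zpow_natCast, Int.toNat_of_nonneg h0]
    conv_lhs => rw [← Int.emod_add_mul_ediv (l + l' + k) p, zpow_add, zpow_mul, zpow_natCast,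
      h.commutator_pow, one_zpow, mul_one]
  have h1 : (l + l' + k) % p < p := Int.emod_lt_of_pos _ (by omega)
  refine ⟨i', j', ⟨((l + l' + k) % p).toNat, by omega⟩, ?_⟩
  rw [← hl'', hi, hj, mul_assoc (x ^ (i' : ℕ)), ← mul_assoc (⁅x, y⁆ ^ l),
    ((h.commute_right.pow_right j').zpow_left l).eq, zpow_add, zpow_add]
  simp only [mul_assoc]

theorem natCard_closure_le (h : PairRel p s t x y) (hp : 0 < p) :
    Finite (Subgroup.closure {x, y}) ∧ Nat.card (Subgroup.closure {x, y}) ≤ p ^ 3 := by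
  choose i j k hijk using fun q : Subgroup.closure {x, y} => h.exists_pow_eq hp q.2
  let F : Subgroup.closure {x, y} → Fin p × Fin p × Fin p := fun q => (i q, j q, k q)
  have hF : Function.Injective F := fun q q' hqq => by
    refine Subtype.ext ?_
    rw [hijk q, hijk q']
    simp only [F, Prod.mk.injEq] at hqq
    rw [hqq.1, hqq.2.1, hqq.2.2]
  refine ⟨Finite.of_injective F hF, (Nat.card_le_card_of_injective F hF).trans ?_⟩
  simp only [Nat.card_prod, Nat.card_fin]
  exact (by ring : p * (p * p) = p ^ 3).le

/-- A group of order `p ^ 3` generated by `a, b` is presented by the relations of `PairRel`. -/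
theorem exists_monoidHom {G : Type} [Group G] {a b : G} (hp : 0 < p) (hG : Nat.card G = p ^ 3)
    (hab : PairRel p s t a b) (hgen : Subgroup.closure {a, b} = ⊤) (hxy : PairRel p s t x y) :
    ∃ f : G →* Q, f a = x ∧ f b = y := by
  have hc : ⁅(a, x), (b, y)⁆ = (⁅a, b⁆, ⁅x, y⁆) := rfl
  have hrel : PairRel p s t (a, x) (b, y) := by
    refine ⟨?_, ?_, ?_, ?_, ?_⟩
    · exact Prod.ext hab.commute_left.eq hxy.commute_left.eq
    · exact Prod.ext hab.commute_right.eq hxy.commute_right.eq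
    · exact Prod.ext hab.commutator_pow hxy.commutator_pow
    · exact Prod.ext hab.left_pow hxy.left_pow
    · exact Prod.ext hab.right_pow hxy.right_pow
  -- The pairs satisfy the same relations, so `R` has at most p³ elements. It maps onto `G`, which
  -- has exactly p³, so it is the graph of a homomorphism.
  let R : Subgroup (G × Q) := Subgroup.closure {(a, x), (b, y)}
  have hRa : (a, x) ∈ R := Subgroup.subset_closure (Set.mem_insert _ _)
  have hRb : (b, y) ∈ R := Subgroup.subset_closure (Set.mem_insert_of_mem _ rfl)
  obtain ⟨hfin, hcard⟩ := hrel.natCard_closure_le hp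
  let π : R →* G := (MonoidHom.fst G Q).comp R.subtype
  have hsurj : Function.Surjective π := by
    rw [← MonoidHom.range_eq_top, eq_top_iff, ← hgen, Subgroup.closure_le]
    rintro g (rfl | rfl)
    · exact ⟨⟨_, hRa⟩, rfl⟩
    · exact ⟨⟨_, hRb⟩, rfl⟩
  have hbij : Function.Bijective π := hsurj.bijective_of_nat_card_le (by rw [hG]; exact hcard)
  let e := MulEquiv.ofBijective π hbij
  refine ⟨((MonoidHom.snd G Q).comp R.subtype).comp e.symm.toMonoidHom, ?_, ?_⟩
  · have : e.symm a = ⟨_, hRa⟩ := by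
      rw [MulEquiv.symm_apply_eq]
      rfl
    exact congrArg (fun r : R => r.1.2) this
  · have : e.symm b = ⟨_, hRb⟩ := by
      rw [MulEquiv.symm_apply_eq]
      rfl
    exact congrArg (fun r : R => r.1.2) this

theorem nonempty_mulEquiv {G K : Type} [Group G] [Group K] {a b : G} {a' b' : K} (hp : 0 < p)
    (hG : Nat.card G = p ^ 3) (hK : Nat.card K = p ^ 3) (hab : PairRel p s t a b)
    (hgen : Subgroup.closure {a, b} = ⊤) (hab' : PairRel p s t a' b')
    (hgen' : Subgroup.closure {a', b'} = ⊤) : Nonempty (G ≃* K) := by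
  obtain ⟨f, hfa, hfb⟩ := exists_monoidHom hp hG hab hgen hab'
  have hsurj : Function.Surjective f := by
    rw [← MonoidHom.range_eq_top, eq_top_iff, ← hgen', Subgroup.closure_le]
    rintro g (rfl | rfl)
    · exact ⟨a, hfa⟩
    · exact ⟨b, hfb⟩
  have : Finite G := Nat.finite_of_card_ne_zero (by rw [hG]; exact (pow_pos hp 3).ne')
  exact ⟨MulEquiv.ofBijective f (hsurj.bijective_of_nat_card_le (by rw [hG, hK]))⟩

end PairRel

/-! ### The two types of nonabelian groups of order p³. -/

section OrderCubed

variable {p : ℕ} {G : Type} [Group G]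

/-- The basic properties of a nonabelian group of order `p ^ 3`. -/
structure IsNonabelianCubed (p : ℕ) (G : Type) [Group G] : Prop where
  natCard_eq : Nat.card G = p ^ 3
  exists_not_commute : ∃ a b : G, ¬Commute a b

theorem commute_of_natCard_eq_pow {n : ℕ} (hp : p.Prime) (hn : n ≤ 2) (hG : Nat.card G = p ^ n)
    (a b : G) : Commute a b := by
  have : Fact p.Prime := ⟨hp⟩
  interval_cases n
  · rw [pow_zero] at hG
    have := (Nat.card_eq_one_iff_unique.1 hG).1
    exact Subsingleton.elim _ _
  · rw [pow_one] at hG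
    have := isCyclic_of_prime_card hG
    exact (IsCyclic.isMulCommutative (α := G)).is_comm.comm a b
  · exact (IsPGroup.isMulCommutative_of_card_eq_prime_sq hG).is_comm.comm a b

namespace IsNonabelianCubed

theorem finite (hp : p.Prime) (hG : IsNonabelianCubed p G) : Finite G :=
  Nat.finite_of_card_ne_zero (by rw [hG.natCard_eq]; exact pow_ne_zero _ hp.ne_zero)

/-- A proper subgroup has order at most p², hence is abelian and cannot contain both elements. -/
theorem closure_eq_top (hp : p.Prime) (hG : IsNonabelianCubed p G) {a b : G}
    (hab : ¬Commute a b) : Subgroup.closure {a, b} = ⊤ := by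
  have := hG.finite hp
  have h1 : Nat.card (Subgroup.closure {a, b}) ∣ p ^ 3 := by
    rw [← hG.natCard_eq]
    exact Subgroup.card_subgroup_dvd_card _
  obtain ⟨n, hn, hcard⟩ := (Nat.dvd_prime_pow hp).1 h1
  have ha : a ∈ Subgroup.closure {a, b} := Subgroup.subset_closure (Set.mem_insert _ _)
  have hb : b ∈ Subgroup.closure {a, b} := Subgroup.subset_closure (Set.mem_insert_of_mem _ rfl)
  have hn3 : n = 3 := by
    by_contra hne
    exact hab (congrArg Subtype.val
      (commute_of_natCard_eq_pow hp (by omega) hcard ⟨a, ha⟩ ⟨b, hb⟩).eq)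
  rw [← Subgroup.card_eq_iff_eq_top, hcard, hn3, hG.natCard_eq]

/-- The centre of a p-group is nontrivial, and order p² is excluded because a cyclic central
quotient makes the group abelian. -/
theorem natCard_center (hp : p.Prime) (hG : IsNonabelianCubed p G) :
    Nat.card (Subgroup.center G) = p := by
  have := hG.finite hp
  have : Fact p.Prime := ⟨hp⟩
  have h1 : Nat.card (Subgroup.center G) ∣ p ^ 3 := by
    rw [← hG.natCard_eq]
    exact Subgroup.card_subgroup_dvd_card _
  obtain ⟨n, hn, hcard⟩ := (Nat.dvd_prime_pow hp).1 h1
  obtain ⟨a, b, hab⟩ := hG.exists_not_commute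
  have hnt : Nontrivial G := ⟨a, b, fun h => hab (h ▸ Commute.refl _)⟩
  have h0 : n ≠ 0 := by
    rintro rfl
    have := (IsPGroup.of_card hG.natCard_eq).center_nontrivial
    rw [pow_zero] at hcard
    exact (Finite.one_lt_card (α := Subgroup.center G)).ne' hcard
  have hq := Subgroup.card_mul_index (Subgroup.center G)
  rw [hcard, hG.natCard_eq, Subgroup.index] at hq
  have h2 : n ≠ 2 := by
    rintro rfl
    have hq' : Nat.card (G ⧸ Subgroup.center G) = p := by
      refine Nat.eq_of_mul_eq_mul_left (pow_pos hp.pos 2) ?_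
      rw [hq]
      ring
    have := isCyclic_of_prime_card hq'
    exact hab ((MonoidHom.isMulCommutative_of_isCyclic_of_ker_le_center
      (QuotientGroup.mk' (Subgroup.center G)) (by rw [QuotientGroup.ker_mk'])).is_comm.comm a b)
  have h3 : n ≠ 3 := by
    rintro rfl
    have : Subgroup.center G = ⊤ := by
      rw [← Subgroup.card_eq_iff_eq_top, hcard, hG.natCard_eq]
    exact hab (Subgroup.mem_center_iff.1 (this ▸ Subgroup.mem_top b) a)
  have : n = 1 := by omega
  rw [hcard, this, pow_one]

theorem commutator_mem_center (hp : p.Prime) (hG : IsNonabelianCubed p G) (g h : G) :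
    ⁅g, h⁆ ∈ Subgroup.center G := by
  have := hG.finite hp
  have : Fact p.Prime := ⟨hp⟩
  have hq := Subgroup.card_mul_index (Subgroup.center G)
  rw [hG.natCard_center hp, hG.natCard_eq, Subgroup.index] at hq
  have hq' : Nat.card (G ⧸ Subgroup.center G) = p ^ 2 := by
    refine Nat.eq_of_mul_eq_mul_left hp.pos ?_
    rw [hq]
    ring
  rw [← QuotientGroup.eq_one_iff]
  refine (map_commutatorElement (QuotientGroup.mk' (Subgroup.center G)) g h).trans ?_
  rw [commutatorElement_eq_one_iff_commute]
  exact commute_of_natCard_eq_pow hp le_rfl hq' _ _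

theorem commutator_commute (hp : p.Prime) (hG : IsNonabelianCubed p G) (g h x : G) :
    Commute ⁅g, h⁆ x :=
  (Subgroup.mem_center_iff.1 (hG.commutator_mem_center hp g h) x).symm

theorem pow_eq_one_of_mem_center (hp : p.Prime) (hG : IsNonabelianCubed p G) {z : G}
    (hz : z ∈ Subgroup.center G) : z ^ p = 1 := by
  have := hG.finite hp
  have h1 : (⟨z, hz⟩ : Subgroup.center G) ^ Nat.card (Subgroup.center G) = 1 := pow_card_eq_one'
  rw [hG.natCard_center hp] at h1
  exact congrArg Subtype.val h1

theorem pow_mem_center (hp : p.Prime) (hG : IsNonabelianCubed p G) (g : G) :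
    g ^ p ∈ Subgroup.center G := by
  rw [Subgroup.mem_center_iff]
  intro h
  have : Commute (g ^ p) h := by
    rw [← commutatorElement_eq_one_iff_commute,
      commutatorElement_pow_left_of_central (hG.commutator_commute hp),
      hG.pow_eq_one_of_mem_center hp (hG.commutator_mem_center hp g h)]
  exact this.eq.symm

theorem exists_pow_eq_of_mem_center (hp : p.Prime) (hG : IsNonabelianCubed p G) {z w : G}
    (hz : z ∈ Subgroup.center G) (hw : w ∈ Subgroup.center G) (hz1 : z ≠ 1) :
    ∃ n : ℕ, z ^ n = w := by
  have : Fact p.Prime := ⟨hp⟩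
  have := hG.finite hp
  have h1 := mem_zpowers_of_prime_card (hG.natCard_center hp) (g := (⟨z, hz⟩ : Subgroup.center G))
    (g' := ⟨w, hw⟩) (fun h => hz1 (congrArg Subtype.val h))
  rw [← mem_powers_iff_mem_zpowers] at h1
  obtain ⟨n, hn⟩ := h1
  exact ⟨n, congrArg Subtype.val hn⟩

theorem pairRel (hp : p.Prime) (hG : IsNonabelianCubed p G) {a b : G} {s t : ℕ}
    (ha : a ^ p = ⁅a, b⁆ ^ s) (hb : b ^ p = ⁅a, b⁆ ^ t) : PairRel p s t a b :=
  ⟨hG.commutator_commute hp _ _ _, hG.commutator_commute hp _ _ _,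
    hG.pow_eq_one_of_mem_center hp (hG.commutator_mem_center hp a b), ha, hb⟩

end IsNonabelianCubed

/-- Sorting the word creates one commutator for each pair of positions. At exponent p the binomial
is divisible by p only for odd p, which is why p = 2 is treated apart. -/
theorem mul_pow_of_central (h : ∀ g h x : G, Commute ⁅g, h⁆ x) (x y : G) (n : ℕ) :
    (x * y) ^ n = x ^ n * y ^ n * ⁅y, x⁆ ^ n.choose 2 := by
  induction n with
  | zero => simp
  | succ n ih =>
    have h1 : y ^ n * x = x * y ^ n * ⁅y, x⁆ ^ n := by
      rw [← commutatorElement_pow_left_of_central h, ← (h _ _ _).eq, commutatorElement_def]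
      group
    rw [pow_succ, ih, mul_assoc (x ^ n * y ^ n), ((h y x (x * y)).pow_left _).eq,
      ← mul_assoc, ← mul_assoc, mul_assoc (x ^ n), h1, ← mul_assoc, ← mul_assoc,
      mul_assoc _ (⁅y, x⁆ ^ n) y, ((h y x y).pow_left n).eq, ← mul_assoc, ← pow_succ,
      mul_assoc (x ^ (n + 1)), ← pow_succ, mul_assoc _ (⁅y, x⁆ ^ n), ← pow_add,
      Nat.choose_succ_succ' n 1, Nat.choose_one_right]

/-- The exponent of the relation `b ^ p = ⁅a, b⁆ ^ t` in the nonabelian groups of order `p ^ 3` with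
trivial Schur multiplier. -/
def minusExponent (p : ℕ) : ℕ := if p = 2 then 1 else 0

/-- Nonabelian groups of order `p ^ 3` fall into two types. -/
theorem IsNonabelianCubed.exists_pairRel (hp : p.Prime) (hG : IsNonabelianCubed p G) :
    ∃ a b : G, ¬Commute a b ∧ (PairRel p 0 0 a b ∨ PairRel p 1 (minusExponent p) a b) := by
  obtain ⟨a₀, b₀, hab₀⟩ := hG.exists_not_commute
  have hcent := hG.commutator_commute hp
  by_cases hp2 : p = 2
  · subst hp2
    have hne : ∀ {a b : G}, ¬Commute a b → ⁅a, b⁆ ≠ 1 := fun h h' =>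
      h (commutatorElement_eq_one_iff_commute.1 h')
    have hsq : ∀ {a b : G}, ¬Commute a b → ∀ g : G, g ^ 2 = 1 ∨ g ^ 2 = ⁅a, b⁆ := by
      intro a b hab g
      obtain ⟨n, hn⟩ := hG.exists_pow_eq_of_mem_center hp (hG.commutator_mem_center hp a b)
        (hG.pow_mem_center hp g) (hne hab)
      have h2 := hG.pow_eq_one_of_mem_center hp (hG.commutator_mem_center hp a b)
      rcases Nat.even_or_odd' n with ⟨k, rfl | rfl⟩
      · left
        rw [← hn, pow_mul, h2, one_pow]
      · right
        rw [← hn, pow_succ, pow_mul, h2, one_pow, one_mul]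
    -- Here (ab)² = a²b²[b,a] = 1, so the pair a, ab is of the first type.
    have key : ∀ {a b : G}, ¬Commute a b → a ^ 2 = 1 → b ^ 2 = ⁅a, b⁆ →
        ∃ a b : G, ¬Commute a b ∧ (PairRel 2 0 0 a b ∨ PairRel 2 1 (minusExponent 2) a b) := by
      intro a b hab ha hb
      have hab' : ¬Commute a (a * b) := fun h => hab (by
        have := (Commute.refl a).inv_right.mul_right h
        rwa [inv_mul_cancel_left] at this)
      refine ⟨a, a * b, hab', Or.inl (hG.pairRel hp (by rw [ha, pow_zero]) ?_)⟩
      rw [mul_pow_of_central hcent, ha, hb, one_mul, Nat.choose_self, pow_one, pow_zero,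
        ← commutatorElement_inv, inv_mul_cancel]
    rcases hsq hab₀ a₀ with ha | ha <;> rcases hsq hab₀ b₀ with hb | hb
    · exact ⟨a₀, b₀, hab₀, Or.inl (hG.pairRel hp (by rw [ha, pow_zero]) (by rw [hb, pow_zero]))⟩
    · exact key hab₀ ha hb
    · refine key (fun h => hab₀ h.symm) hb ?_
      have h2 := hG.pow_eq_one_of_mem_center hp (hG.commutator_mem_center hp a₀ b₀)
      rw [ha, ← commutatorElement_inv b₀ a₀, inv_eq_iff_mul_eq_one, ← commutatorElement_inv a₀ b₀,
        ← mul_inv_rev, ← sq, h2, inv_one]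
    · exact ⟨a₀, b₀, hab₀, Or.inr (hG.pairRel hp (by rw [ha, pow_one]) (by
        rw [hb, minusExponent, if_pos rfl, pow_one]))⟩
  · have hodd : p ∣ p.choose 2 := hp.dvd_choose_self two_ne_zero
      (lt_of_le_of_ne hp.two_le (Ne.symm hp2))
    have hmul : ∀ x y : G, (x * y) ^ p = x ^ p * y ^ p := by
      intro x y
      obtain ⟨k, hk⟩ := hodd
      rw [mul_pow_of_central hcent, hk, pow_mul,
        hG.pow_eq_one_of_mem_center hp (hG.commutator_mem_center hp y x), one_pow, mul_one]
    by_cases hexp : ∀ g : G, g ^ p = 1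
    · exact ⟨a₀, b₀, hab₀, Or.inl (hG.pairRel hp (by rw [hexp, pow_zero])
        (by rw [hexp, pow_zero]))⟩
    · push Not at hexp
      obtain ⟨a, ha⟩ := hexp
      obtain ⟨b, hb⟩ : ∃ b, ¬Commute a b := by
        by_contra! hall
        have hac : a ∈ Subgroup.center G := Subgroup.mem_center_iff.2 fun g => (hall g).symm
        exact ha (hG.pow_eq_one_of_mem_center hp hac)
      have hap := hG.pow_mem_center hp a
      -- `a ^ p` generates the centre, so a power of `a` corrects `b` to an element with trivial
      -- p-th power.
      obtain ⟨k, hk⟩ := hG.exists_pow_eq_of_mem_center hp hap (hG.pow_mem_center hp b) ha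
      set b' := b * (a ^ k)⁻¹ with hb'
      have hb'p : b' ^ p = 1 := by
        rw [hb', hmul, inv_pow, ← pow_mul, mul_comm k, pow_mul, hk, mul_inv_cancel]
      have hab' : ¬Commute a b' := fun h => hb (by
        have := h.mul_right ((Commute.refl a).pow_right k)
        rwa [hb', inv_mul_cancel_right] at this)
      have hne : ⁅a, b'⁆ ≠ 1 := fun h' => hab' (commutatorElement_eq_one_iff_commute.1 h')
      -- A power of `b'` makes the commutator exactly `a ^ p`.
      obtain ⟨r, hr⟩ := hG.exists_pow_eq_of_mem_center hp (hG.commutator_mem_center hp a b') hap hne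
      have hcr : ⁅a, b' ^ r⁆ = a ^ p := by
        rw [← hr]
        exact map_pow (MonoidHom.mk' (fun h => ⁅a, h⁆) fun h h' =>
          commutatorElement_mul_right_of_central hcent a h h') b' r
      refine ⟨a, b' ^ r, fun h => ha ?_, Or.inr (hG.pairRel hp (by rw [hcr, pow_one]) ?_)⟩
      · rw [← hcr, commutatorElement_eq_one_iff_commute.2 h]
      · rw [minusExponent, if_neg hp2, pow_zero, ← pow_mul, mul_comm, pow_mul, hb'p, one_pow]

end OrderCubed

/-! ### Vanishing of H² for the second type. -/

/-- In a central extension, lifts of a pair of type `(1, minusExponent p)` can be normalized to satisfy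
the same relations. -/
theorem pairRel_of_pow_eq {p : ℕ} (hp : p.Prime) {E : Type} [Group E] {x y : E}
    (hx : x ^ p = ⁅x, y⁆) (hy : y ^ p = ⁅x, y⁆ ^ minusExponent p)
    (hcent : ∀ z, Commute (⁅x, y⁆ ^ p) z) : PairRel p 1 (minusExponent p) x y := by
  have hcx : Commute ⁅x, y⁆ x := by
    rw [← hx]
    exact (Commute.refl x).pow_left p
  -- Conjugating `hx` by `y` shows that `y` commutes with the commutator once the p-th power of the
  -- latter is trivial.
  have hconj : y * ⁅x, y⁆ * y⁻¹ = (⁅x, y⁆ ^ p)⁻¹ * ⁅x, y⁆ := by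
    calc y * ⁅x, y⁆ * y⁻¹ = (y * x * y⁻¹) ^ p := by rw [conj_pow, hx]
      _ = (⁅x, y⁆⁻¹ * x) ^ p := by rw [PairRel.conj_left]
      _ = _ := by rw [hcx.inv_left.mul_pow, inv_pow, hx]
  have hcp : ⁅x, y⁆ ^ p = 1 := by
    by_cases hp2 : p = 2
    -- For p = 2 the commutator is a power of `y`.
    · have h1 : y * ⁅x, y⁆ * y⁻¹ = ⁅x, y⁆ := by
        rw [minusExponent, if_pos hp2, pow_one] at hy
        rw [← hy, ((Commute.refl y).pow_right p).eq, mul_inv_cancel_right]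
      rw [h1] at hconj
      exact inv_eq_one.1 (mul_eq_right.1 hconj.symm)
    · rw [minusExponent, if_neg hp2, pow_zero] at hy
      set c := ⁅x, y⁆ with hc
      set w := c ^ p with hw
      have hwp : w ^ p = 1 := by
        have h1 : y * w * y⁻¹ = w := by rw [← (hcent y).eq, mul_inv_cancel_right]
        have h2 : y * w * y⁻¹ = (w ^ p)⁻¹ * w := by
          calc y * w * y⁻¹ = (y * c * y⁻¹) ^ p := by rw [conj_pow]
            _ = (w⁻¹ * c) ^ p := by rw [hconj]
            _ = _ := by rw [(hcent c).inv_left.mul_pow, inv_pow]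
        rw [h1] at h2
        exact inv_eq_one.1 (mul_eq_right.1 h2.symm)
      -- At n = p the left side is x because y^p = 1. The power of w with exponent p.choose 2 is
      -- trivial because w^p = 1 and p is odd, so w = 1 remains.
      have hiter : ∀ n : ℕ, y ^ n * x * (y ^ n)⁻¹ = w ^ n.choose 2 * (c ^ n)⁻¹ * x := by
        intro n
        induction n with
        | zero => simp
        | succ n ih =>
          calc y ^ (n + 1) * x * (y ^ (n + 1))⁻¹
              = y * (y ^ n * x * (y ^ n)⁻¹) * y⁻¹ := by rw [pow_succ']; group
            _ = y * (w ^ n.choose 2) * y⁻¹ * (y * c * y⁻¹)⁻¹ ^ n * (y * x * y⁻¹) := by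
              rw [ih, inv_pow, conj_pow]; group
            _ = w ^ n.choose 2 * (w ^ n * (c ^ n)⁻¹) * (c⁻¹ * x) := by
              rw [← ((hcent y).pow_left _).eq, mul_inv_cancel_right, hconj, PairRel.conj_left,
                mul_inv_rev, inv_inv, ← (hcent _).eq, (hcent _).mul_pow, inv_pow]
            _ = w ^ (n + 1).choose 2 * (c ^ (n + 1))⁻¹ * x := by
              rw [Nat.choose_succ_succ' n 1, Nat.choose_one_right, add_comm n, pow_add, pow_succ' c,
                mul_inv_rev]
              simp only [mul_assoc]
      have h3 := hiter p
      rw [hy, one_mul, inv_one, mul_one, ← hw] at h3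
      obtain ⟨k, hk⟩ := hp.dvd_choose_self two_ne_zero
        (lt_of_le_of_ne hp.two_le (Ne.symm hp2))
      rw [hk, pow_mul, hwp, one_pow, one_mul] at h3
      exact inv_eq_one.1 (mul_eq_right.1 h3.symm)
  have hcy : Commute ⁅x, y⁆ y := by
    rw [hcp, inv_one, one_mul, mul_inv_eq_iff_eq_mul] at hconj
    exact hconj.symm
  exact ⟨hcx, hcy, hcp, by rw [hx, pow_one], hy⟩

/-- The cohomology of a nonabelian group of order `p ^ 3` of the second type vanishes. -/
theorem cohomologyClass_eq_zero_of_pairRel {p : ℕ} (hp : p.Prime) {K : Type} [Group K] {a b : K}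
    (hK : Nat.card K = p ^ 3) (hab : PairRel p 1 (minusExponent p) a b)
    (hgen : Subgroup.closure {a, b} = ⊤) (α : TwoCocycle ℂ K) : cohomologyClass α = 0 := by
  rw [cohomologyClass_eq_zero_iff]
  let hf := α.isCocycle
  set c := ⁅hf.lift a, hf.lift b⁆ with hc
  have hprojc : hf.proj c = ⁅a, b⁆ := map_commutatorElement hf.proj _ _
  -- A lift satisfies its relation up to a scalar, removed by a p-th root in ℂˣ. Rescaling leaves
  -- the commutator unchanged, so both relations hold at once.
  have hnorm : ∀ (g : K) (n : ℕ), g ^ p = ⁅a, b⁆ ^ n → ∃ m, (hf.incl m * hf.lift g) ^ p = c ^ n := by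
    intro g n hg
    have h1 : hf.proj (c ^ n * (hf.lift g ^ p)⁻¹) = 1 := by
      rw [map_mul, map_inv, map_pow, map_pow, hprojc, hf.proj_lift, hg, mul_inv_cancel]
    obtain ⟨m, hm⟩ := hf.exists_incl_eq h1
    obtain ⟨m', hm'⟩ := exists_pow_eq_units p hp.ne_zero m
    refine ⟨m', ?_⟩
    rw [(hf.incl_commute m' _).mul_pow, ← map_pow, hm', hm, inv_mul_cancel_right]
  obtain ⟨m, hm⟩ := hnorm a 1 hab.left_pow
  obtain ⟨n, hn⟩ := hnorm b _ hab.right_pow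
  have hcomm : ⁅hf.incl m * hf.lift a, hf.incl n * hf.lift b⁆ = c :=
    SymplecticCover.commutatorElement_mul_mul_of_central (hf.incl_commute m) (hf.incl_commute n) _ _
  have hcent : ∀ z, Commute (c ^ p) z := by
    have h1 : hf.proj (c ^ p) = 1 := by rw [map_pow, hprojc, hab.commutator_pow]
    obtain ⟨k, hk⟩ := hf.exists_incl_eq h1
    rw [← hk]
    exact hf.incl_commute k
  have hrel : PairRel p 1 (minusExponent p) (hf.incl m * hf.lift a) (hf.incl n * hf.lift b) :=
    pairRel_of_pow_eq hp (by rw [hm, hcomm, pow_one]) (by rw [hn, hcomm]) (by rwa [hcomm])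
  obtain ⟨σ, hσa, hσb⟩ := PairRel.exists_monoidHom hp.pos hK hab hgen hrel
  refine hf.exists_coboundary_of_section σ fun g => ?_
  have h2 : hf.proj.comp σ = MonoidHom.id K := by
    refine MonoidHom.eq_of_eqOn_dense hgen ?_
    rintro g (rfl | rfl)
    · change hf.proj (σ g) = g
      rw [hσa, map_mul, hf.proj_incl, hf.proj_lift, one_mul]
    · change hf.proj (σ g) = g
      rw [hσb, map_mul, hf.proj_incl, hf.proj_lift, one_mul]
  exact DFunLike.congr_fun h2 g

/-! ### A projective representation that does not lift: nonvanishing for the first type. -/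

/-- If `H²(G, ℂˣ)` vanishes, projective representations of `G` lift. -/
theorem exists_lift_of_cohomologyClass_eq_zero {G W Q : Type} [Group G] [Group W] [Group Q]
    (hG : ∀ α : TwoCocycle ℂ G, cohomologyClass α = 0) (z : ℂˣ →* W) (hz : Function.Injective z)
    (hzc : ∀ m w, Commute (z m) w) (π : W →* Q) (hπ : Function.Surjective π)
    (hker : ∀ w, π w = 1 ↔ ∃ m, z m = w) (ρ : G →* Q) : ∃ σ : G →* W, ∀ g, π (σ g) = ρ g := by
  choose s hs using fun g => hπ (ρ g)
  -- The failure of the chosen lifts to be multiplicative is a cocycle, and a trivializing cochain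
  -- corrects them.
  have h1 : ∀ g h, ∃ m, z m * s (g * h) = s g * s h := fun g h => by
    obtain ⟨m, hm⟩ := (hker (s g * s h * (s (g * h))⁻¹)).1 (by
      rw [map_mul, map_mul, map_inv, hs, hs, hs, map_mul, mul_inv_cancel])
    exact ⟨m, by rw [hm, inv_mul_cancel_right]⟩
  choose f hf using h1
  have hcoc : IsCocycle f := fun g h j => by
    have h2 : z (f (g * h) j) * z (f g h) * s (g * (h * j)) = s g * s h * s j := by
      rw [← mul_assoc g, (hzc _ (z (f g h))).eq, mul_assoc, hf, ← mul_assoc, hf]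
    have h3 : z (f h j) * z (f g (h * j)) * s (g * (h * j)) = s g * s h * s j := by
      rw [mul_assoc, hf, ← mul_assoc, (hzc _ (s g)).eq, mul_assoc, hf, mul_assoc]
    rw [← h3, ← map_mul, ← map_mul] at h2
    exact hz (mul_right_cancel h2)
  obtain ⟨c, hc⟩ := (cohomologyClass_eq_zero_iff _).1 (hG hcoc.toTwoCocycle)
  refine ⟨MonoidHom.mk' (fun g => z (c g)⁻¹ * s g) fun g h => ?_, fun g => ?_⟩
  · have h2 : z (c g)⁻¹ * s g * (z (c h)⁻¹ * s h) = z ((c g)⁻¹ * (c h)⁻¹) * (s g * s h) := by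
      rw [mul_assoc, ← mul_assoc (s g), ← (hzc (c h)⁻¹ (s g)).eq, mul_assoc, ← mul_assoc,
        ← map_mul]
    have h3 : (c (g * h))⁻¹ = (c g)⁻¹ * (c h)⁻¹ * f g h := by
      rw [← mul_inv, hc, IsCocycle.unitVal_toTwoCocycle, mul_inv, mul_right_comm, inv_mul_cancel,
        one_mul]
    rw [h2, ← hf, ← mul_assoc, ← map_mul, h3]
  · change π (z (c g)⁻¹ * s g) = ρ g
    rw [map_mul, (hker _).2 ⟨_, rfl⟩, one_mul, hs]

section Projective

variable {p : ℕ}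

/-- The cyclic shift of coordinates. -/
def shiftEquiv (p : ℕ) : (ZMod p → ℂ) ≃ₗ[ℂ] (ZMod p → ℂ) :=
  LinearEquiv.funCongrLeft ℂ ℂ (Equiv.addRight 1)

/-- A diagonal linear automorphism. -/
def diagEquiv (p : ℕ) : (ZMod p → ℂˣ) →* ((ZMod p → ℂ) ≃ₗ[ℂ] (ZMod p → ℂ)) where
  toFun d :=
    { toFun := fun f i => d i * f i
      map_add' := fun _ _ => funext fun _ => mul_add _ _ _
      map_smul' := fun _ _ => funext fun _ => mul_left_comm _ _ _
      invFun := fun f i => ((d i)⁻¹ : ℂˣ) * f i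
      left_inv := fun _ => funext fun _ => Units.inv_mul_cancel_left _ _
      right_inv := fun _ => funext fun _ => Units.mul_inv_cancel_left _ _ }
  map_one' := LinearEquiv.ext fun _ => funext fun _ => one_mul _
  map_mul' _ _ := LinearEquiv.ext fun _ => funext fun _ => mul_assoc _ _ _

theorem diagEquiv_apply (d : ZMod p → ℂˣ) (f : ZMod p → ℂ) (i : ZMod p) :
    diagEquiv p d f i = d i * f i := rfl

theorem diagEquiv_injective : Function.Injective (diagEquiv p) := fun d d' h => by
  funext i
  have h1 := congrFun (LinearEquiv.congr_fun h (fun _ => 1)) i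
  simp only [diagEquiv_apply, mul_one] at h1
  exact Units.ext h1

/-- Scalar automorphisms. -/
def scalarEquiv (p : ℕ) : ℂˣ →* ((ZMod p → ℂ) ≃ₗ[ℂ] (ZMod p → ℂ)) :=
  (diagEquiv p).comp (Pi.constMonoidHom (ZMod p) ℂˣ)

theorem scalarEquiv_commute (m : ℂˣ) (w : (ZMod p → ℂ) ≃ₗ[ℂ] (ZMod p → ℂ)) :
    Commute (scalarEquiv p m) w := LinearEquiv.ext fun f => (map_smul w (m : ℂ) f).symm

theorem shiftEquiv_pow (n : ℕ) (f : ZMod p → ℂ) (i : ZMod p) :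
    (shiftEquiv p ^ n) f i = f (i + n) := by
  induction n generalizing i with
  | zero => simp
  | succ n ih =>
    rw [pow_succ']
    change (shiftEquiv p ^ n) f (i + 1) = _
    rw [ih]
    congr 1
    push_cast
    ring

/-- At n = p the product runs over all of ℤ/p, so the p-th power is a scalar for every `d`,
including when p = 2. -/
theorem shift_mul_diag_pow (d : ZMod p → ℂˣ) (n : ℕ) (f : ZMod p → ℂ) (i : ZMod p) :
    ((shiftEquiv p * diagEquiv p d) ^ n) f i =
      (∏ l ∈ Finset.range n, d (i + l + 1) : ℂˣ) * f (i + n) := by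
  induction n generalizing i with
  | zero => simp
  | succ n ih =>
    rw [pow_succ']
    change (d (i + 1) : ℂ) * ((shiftEquiv p * diagEquiv p d) ^ n) f (i + 1) = _
    rw [ih, Finset.prod_range_succ', Units.val_mul, mul_comm (Units.val (Finset.prod _ _)), mul_assoc]
    have h1 : ∀ l : ℕ, i + ((l + 1 : ℕ) : ZMod p) + 1 = i + 1 + l + 1 := fun l => by
      push_cast; ring
    have h2 : i + ((n + 1 : ℕ) : ZMod p) = i + 1 + n := by push_cast; ring
    simp only [h1, h2, Nat.cast_zero, add_zero]
    ring

/-- A sequence on `ℤ/p` with prescribed geometric growth of ratios. -/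
theorem exists_ratio_eq (p : ℕ) [Fact p.Prime] : ∃ (d : ZMod p → ℂˣ) (μ : ℂˣ), ∀ i,
    d (i + 1) = d i * (μ * stdChar p i) := by
  have hp := (Fact.out : p.Prime)
  have : NeZero p := ⟨hp.ne_zero⟩
  -- The ratios μζ^i must multiply to 1 around the cycle, which forces this value of μ^p.
  obtain ⟨μ, hμ⟩ := exists_pow_eq_units p hp.ne_zero (stdChar p 1 ^ p.choose 2)⁻¹
  have hstd : ∀ n : ℕ, stdChar p (n : ZMod p) = stdChar p 1 ^ n := fun n => by
    rw [← stdChar_nsmul, nsmul_one]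
  refine ⟨fun i => μ ^ i.val * stdChar p 1 ^ i.val.choose 2, μ, fun i => ?_⟩
  have hi : stdChar p i = stdChar p 1 ^ i.val := by rw [← hstd, ZMod.natCast_zmod_val]
  rw [hi]
  have h1 : μ ^ i.val * stdChar p 1 ^ i.val.choose 2 * (μ * stdChar p 1 ^ i.val) =
      μ ^ (i.val + 1) * stdChar p 1 ^ (i.val + 1).choose 2 := by
    rw [Nat.choose_succ_succ' i.val 1, Nat.choose_one_right, mul_mul_mul_comm, ← pow_succ,
      ← pow_add, add_comm i.val (i.val.choose _)]
  simp only
  rw [h1]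
  rcases Nat.lt_or_ge (i.val + 1) p with h | h
  · have h2 : (i + 1).val = i.val + 1 := by
      have : i + 1 = ((i.val + 1 : ℕ) : ZMod p) := by
        push_cast
        rw [ZMod.natCast_zmod_val]
      rw [this, ZMod.val_natCast_of_lt h]
    rw [h2]
  · have h2 : i.val + 1 = p := le_antisymm (ZMod.val_lt i) h
    have h3 : i + 1 = 0 := by
      have : i + 1 = ((i.val + 1 : ℕ) : ZMod p) := by
        push_cast
        rw [ZMod.natCast_zmod_val]
      rw [this, h2, CharP.cast_eq_zero]
    rw [h3, h2, hμ]
    simp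

theorem prod_range_shift [Fact p.Prime] (d : ZMod p → ℂˣ) (i : ZMod p) :
    ∏ l ∈ Finset.range p, d (i + l + 1) = ∏ j, d j := by
  have hp := (Fact.out : p.Prime)
  have : NeZero p := ⟨hp.ne_zero⟩
  refine Finset.prod_bij' (fun l _ => i + l + 1) (fun j _ => (j - i - 1).val) ?_ ?_ ?_ ?_ ?_
  · simp
  · intro j _
    exact Finset.mem_range.2 (ZMod.val_lt _)
  · intro l hl
    have : i + (l : ZMod p) + 1 - i - 1 = l := by ring
    rw [this, ZMod.val_natCast_of_lt (Finset.mem_range.1 hl)]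
  · intro j _
    rw [ZMod.natCast_zmod_val]
    ring
  · simp

/-- A nonabelian group of order `p ^ 3` of the first type has nontrivial cohomology. -/
theorem exists_cohomologyClass_ne_zero [Fact p.Prime] {G : Type} [Group G] {a b : G}
    (hG : Nat.card G = p ^ 3) (hab : PairRel p 0 0 a b) (hgen : Subgroup.closure {a, b} = ⊤) :
    ∃ α : TwoCocycle ℂ G, cohomologyClass α ≠ 0 := by
  by_contra! hzero
  have hp := (Fact.out : p.Prime)
  obtain ⟨d, μ, hd⟩ := exists_ratio_eq p
  -- Modulo scalars `x` and `y` satisfy the relations of `a` and `b`, but `⁅x, y⁆` commutes with `x`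
  -- only up to ζ. A lift would send `⁅a, b⁆` to `⁅x, y⁆`, whatever the scalars, and make it commute
  -- with `x`.
  let W := (ZMod p → ℂ) ≃ₗ[ℂ] (ZMod p → ℂ)
  let x : W := shiftEquiv p
  let y : W := shiftEquiv p * diagEquiv p d
  let u : ZMod p → ℂˣ := fun i => μ * stdChar p (i + 1)
  have hxy : ⁅x, y⁆ = diagEquiv p u := by
    have h1 : x * y = diagEquiv p u * (y * x) := by
      refine LinearEquiv.ext fun f => funext fun i => ?_
      change (d (i + 1 + 1) : ℂ) * f (i + 1 + 1) = (u i : ℂ) * ((d (i + 1) : ℂ) * f (i + 1 + 1))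
      rw [hd (i + 1), ← mul_assoc (u i : ℂ), ← Units.val_mul, mul_comm (u i)]
    rw [commutatorElement_def, mul_assoc, ← mul_inv_rev, h1, mul_inv_cancel_right]
  have hshift : x * diagEquiv p u = scalarEquiv p (stdChar p 1) * (diagEquiv p u * x) := by
    refine LinearEquiv.ext fun f => funext fun i => ?_
    change (u (i + 1) : ℂ) * f (i + 1) = (stdChar p 1 : ℂ) * ((u i : ℂ) * f (i + 1))
    rw [← mul_assoc, ← Units.val_mul]
    congr 2
    simp only [u]
    rw [stdChar_add (i + 1) 1, ← mul_assoc, mul_comm]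
  have hnormal : (scalarEquiv p).range.Normal := ⟨by
    rintro _ ⟨m, rfl⟩ w
    rw [← (scalarEquiv_commute m w).eq, mul_inv_cancel_right]
    exact ⟨m, rfl⟩⟩
  let π : W →* W ⧸ (scalarEquiv p).range := QuotientGroup.mk' _
  have hker : ∀ w, π w = 1 ↔ ∃ m, scalarEquiv p m = w := fun w =>
    QuotientGroup.eq_one_iff w
  have hπxy : ⁅π x, π y⁆ = π (diagEquiv p u) := by rw [← map_commutatorElement, hxy]
  have hcx : π x * π (diagEquiv p u) = π (diagEquiv p u) * π x := by
    rw [← map_mul, hshift, map_mul, (hker _).2 ⟨_, rfl⟩, one_mul, map_mul]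
  have hcd : π (diagEquiv p d) * π (diagEquiv p u) = π (diagEquiv p u) * π (diagEquiv p d) := by
    rw [← map_mul, ← map_mul, ← map_mul, ← map_mul, mul_comm]
  have hrel : PairRel p 0 0 (π x) (π y) := by
    refine ⟨?_, ?_, ?_, ?_, ?_⟩
    · rw [hπxy]
      exact hcx.symm
    · rw [hπxy]
      have : π y = π x * π (diagEquiv p d) := map_mul π _ _
      rw [this]
      exact Commute.mul_right hcx.symm hcd.symm
    · rw [hπxy, ← map_pow, hker]
      refine ⟨μ ^ p, ?_⟩
      rw [← map_pow]
      refine congrArg (diagEquiv p) (funext fun i => ?_)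
      change μ ^ p = (μ * stdChar p (i + 1)) ^ p
      rw [mul_pow, ← stdChar_nsmul, nsmul_eq_mul, CharP.cast_eq_zero, zero_mul, stdChar_zero,
        mul_one]
    · rw [pow_zero, ← map_pow, hker]
      refine ⟨1, ?_⟩
      rw [map_one]
      refine LinearEquiv.ext fun f => funext fun i => ?_
      rw [shiftEquiv_pow, CharP.cast_eq_zero, add_zero]
      rfl
    · rw [pow_zero, ← map_pow, hker]
      refine ⟨∏ j, d j, LinearEquiv.ext fun f => funext fun i => ?_⟩
      rw [shift_mul_diag_pow, prod_range_shift, CharP.cast_eq_zero, add_zero]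
      rfl
  obtain ⟨ρ, hρa, hρb⟩ := PairRel.exists_monoidHom hp.pos hG hab hgen hrel
  obtain ⟨σ, hσ⟩ := exists_lift_of_cohomologyClass_eq_zero hzero (scalarEquiv p)
    (diagEquiv_injective.comp (Function.const_injective)) scalarEquiv_commute π
    (QuotientGroup.mk'_surjective _) hker ρ
  have hlift : ∀ g w, ρ g = π w → ∃ m, σ g = scalarEquiv p m * w := by
    intro g w hgw
    obtain ⟨m, hm⟩ := (hker (σ g * w⁻¹)).1 (by
      rw [map_mul, map_inv, hσ, hgw, mul_inv_cancel])
    exact ⟨m, by rw [hm, inv_mul_cancel_right]⟩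
  obtain ⟨m, hm⟩ := hlift a x hρa
  obtain ⟨n, hn⟩ := hlift b y hρb
  have h1 : σ ⁅a, b⁆ = diagEquiv p u := by
    rw [map_commutatorElement, hm, hn, SymplecticCover.commutatorElement_mul_mul_of_central
      (scalarEquiv_commute m) (scalarEquiv_commute n), hxy]
  have h2 : Commute (σ ⁅a, b⁆) (σ a) := hab.commute_left.map σ
  rw [h1, hm] at h2
  have h3 : Commute (diagEquiv p u) x := by
    have := (scalarEquiv_commute m⁻¹ (diagEquiv p u)).symm.mul_right h2
    rwa [map_inv, inv_mul_cancel_left] at this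
  have h4 : scalarEquiv p (stdChar p 1) = 1 :=
    mul_eq_right.1 (hshift.symm.trans h3.eq.symm)
  have h5 : stdChar p 1 = stdChar p 0 := by
    rw [stdChar_zero]
    exact (diagEquiv_injective.comp (Function.const_injective)) (h4.trans (map_one (scalarEquiv p)).symm)
  exact one_ne_zero (stdChar_injective h5)

end Projective

/-! ### The case n = 1 and the main theorem. -/

theorem commute_of_algEquiv {G K : Type} [Group G] [Group K] (hK : ∀ x y : K, Commute x y)
    (e : TwistedGroupRing (0 : TwoCocycle ℂ G) ≃ₐ[ℂ] TwistedGroupRing (0 : TwoCocycle ℂ K))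
    (g h : G) : Commute g h := by
  have hmul : ∀ (L : Type) [Group L] (x y : L), TwistedGroupRing.of (0 : TwoCocycle ℂ L) x *
      TwistedGroupRing.of 0 y = TwistedGroupRing.of 0 (x * y) := fun L _ x y => by
    rw [TwistedGroupRing.of_mul_of, TwoCocycle.unitVal_zero, Units.val_one, one_smul]
  have hcomm : ∀ x y : TwistedGroupRing (0 : TwoCocycle ℂ K), Commute x y := by
    intro x y
    induction TwistedGroupRing.mem_span_of 0 x using Submodule.span_induction with
    | zero => exact Commute.zero_left _
    | add x x' _ _ hx hx' => exact hx.add_left hx'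
    | smul c x _ hx => exact hx.smul_left c
    | mem x hx =>
      obtain ⟨k, rfl⟩ := hx
      induction TwistedGroupRing.mem_span_of 0 y using Submodule.span_induction with
      | zero => exact Commute.zero_right _
      | add x x' _ _ hx hx' => exact hx.add_right hx'
      | smul c x _ hx => exact hx.smul_right c
      | mem x hx =>
        obtain ⟨l, rfl⟩ := hx
        rw [commute_iff_eq, hmul, hmul, (hK k l).eq]
  have h1 : TwistedGroupRing.of (0 : TwoCocycle ℂ G) (g * h) = TwistedGroupRing.of 0 (h * g) := by
    rw [← hmul, ← hmul]
    refine e.injective ?_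
    rw [map_mul, map_mul, (hcomm _ _).eq]
  exact (TwistedGroupRing.basis 0).injective h1

/-- The zero class corresponds to the zero class, so the ordinary group algebras are isomorphic:
their dimension gives the order, their noncommutativity the rest. -/
theorem IsNonabelianCubed.of_twistedGroupRingRel {p : ℕ} {G K : Type} [Group G] [Group K]
    (hG : IsNonabelianCubed p G) (h : TwistedGroupRingRel ℂ G K) : IsNonabelianCubed p K := by
  obtain ⟨φ, hφ⟩ := h
  obtain ⟨e⟩ := hφ 0 0 (by
    rw [← cohomologyClassHom_apply, ← cohomologyClassHom_apply, map_zero, map_zero, map_zero])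
  refine ⟨?_, ?_⟩
  · rw [← TwistedGroupRing.finrank_eq 0, ← e.toLinearEquiv.finrank_eq, TwistedGroupRing.finrank_eq,
      hG.natCard_eq]
  · by_contra! hK
    obtain ⟨a, b, hab⟩ := hG.exists_not_commute
    exact hab (commute_of_algEquiv hK e a b)

/-- Groups of the same type are isomorphic by their presentation, and different types are excluded
because only one of them has vanishing H². -/
theorem IsNonabelianCubed.nonempty_mulEquiv_of_rel {p : ℕ} (hp : p.Prime) {G K : Type} [Group G]
    [Group K] (hG : IsNonabelianCubed p G) (h : TwistedGroupRingRel ℂ G K) : Nonempty (G ≃* K) := by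
  have : Fact p.Prime := ⟨hp⟩
  have hK := hG.of_twistedGroupRingRel h
  obtain ⟨φ, -⟩ := h
  obtain ⟨a, b, hab, hrel⟩ := hG.exists_pairRel hp
  obtain ⟨a', b', hab', hrel'⟩ := hK.exists_pairRel hp
  have hgen := hG.closure_eq_top hp hab
  have hgen' := hK.closure_eq_top hp hab'
  rcases hrel with hrel | hrel <;> rcases hrel' with hrel' | hrel'
  · exact PairRel.nonempty_mulEquiv hp.pos hG.natCard_eq hK.natCard_eq hrel hgen hrel' hgen'
  · obtain ⟨α, hα⟩ := exists_cohomologyClass_ne_zero hG.natCard_eq hrel hgen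
    refine absurd (φ.injective ?_) hα
    obtain ⟨β, hβ⟩ := cohomologyClassHom_surjective (φ (cohomologyClass α))
    rw [← hβ, map_zero]
    exact cohomologyClass_eq_zero_of_pairRel hp hK.natCard_eq hrel' hgen' β
  · obtain ⟨β, hβ⟩ := exists_cohomologyClass_ne_zero hK.natCard_eq hrel' hgen'
    refine absurd (φ.symm.injective ?_) hβ
    obtain ⟨α, hα⟩ := cohomologyClassHom_surjective (φ.symm (cohomologyClass β))
    rw [← hα, map_zero]
    exact cohomologyClass_eq_zero_of_pairRel hp hG.natCard_eq hrel hgen α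
  · exact PairRel.nonempty_mulEquiv hp.pos hG.natCard_eq hK.natCard_eq hrel hgen hrel' hgen'

theorem IsExtraSpecial.exists_not_commute {p : ℕ} (hp : p.Prime) {G : Type} [Group G]
    (hG : IsExtraSpecial p G) : ∃ a b : G, ¬Commute a b := by
  by_contra! hcomm
  have h1 : Subgroup.center G = ⊤ :=
    eq_top_iff.2 fun g _ => Subgroup.mem_center_iff.2 fun h => hcomm h g
  have h2 := hG.card_center
  rw [hG.center_eq_commutator, (commutator_eq_bot_iff_center_eq_top G).2 h1, Subgroup.card_bot] at h2
  exact hp.one_lt.ne h2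

theorem theorem1p6 (p n : ℕ) (hp : p.Prime) (hn : 1 ≤ n)
    (G H : Type) [Group G] [Group H]
    (hG : IsExtraSpecial p G) (hH : IsExtraSpecial p H)
    (hGcard : Nat.card G = p ^ (2 * n + 1)) (hHcard : Nat.card H = p ^ (2 * n + 1)) :
    (n = 1 → ∀ (K : Type) [Group K], TwistedGroupRingRel ℂ G K ↔ Nonempty (G ≃* K)) ∧
    (1 < n → TwistedGroupRingRel ℂ G H) := by
  refine ⟨fun h1 K _ => ⟨fun h => ?_, fun ⟨e⟩ => ?_⟩,
    fun h => hG.twistedGroupRingRel hp hH hGcard hHcard h⟩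
  · subst h1
    exact IsNonabelianCubed.nonempty_mulEquiv_of_rel hp ⟨hGcard, hG.exists_not_commute hp⟩ h
  · have : Finite G := Nat.finite_of_card_ne_zero (by rw [hGcard]; exact pow_ne_zero _ hp.ne_zero)
    exact twistedGroupRingRel_of_mulEquiv e
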